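/- Let $\mathcal N=\{1,\dots,n\}$ be a set of products. A marginal distribution model (MDM) is given by deterministic utilities $\nu_1,\dots,\nu_n\in\mathbb R$ and probability distributions $F_1,\dots,F_n$ on $\mathbb R$, each absolutely continuous, with distribution function strictly increasing on its support, and with finite first absolute moment. For a nonempty assortment $S\subseteq\mathcal N$, its choice probabilities are $p_{i,S}=\mathbb P_{\theta^*}\big(i=\arg\max_{j\in S}(\nu_j+\tilde\epsilon_j)\big)$, $i\in S$, where $\theta^*$ maximizes $\mathbb E_\theta[\max_{j\in S}(\nu_j+\tilde\epsilon_j)]$ over all joint distributions $\theta$ of $(\tilde\epsilon_1,\dots,\tilde\epsilon_n)$ with marginals $F_1,\dots,F_n$. For a collection $\mathcal S$ of assortments let $\mathcal I_{\mathcal S}=\{(i,S): i\in S,\ S\in\mathcal S\}$ and let $\mathcal P_{\rm mdm}(\mathcal S)\subseteq\mathbb R^{\mathcal I_{\mathcal S}}$ be the set of all choice probability collections $(p_{i,S})_{(i,S)\in\mathcal I_{\mathcal S}}$ that arise from a single MDM. Let $\boldsymbol p_{\mathcal S}\in\mathcal P_{\rm mdm}(\mathcal S)$, let $A\subseteq\mathcal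 N$ be a nonempty assortment with $A\notin\mathcal S$, and let $r_i\in(0,\infty)$ for $i\in\mathcal N$. Put $\mathcal U_A=\{\boldsymbol x_A=(x_{i,A})_{i\in A}: (\boldsymbol p_{\mathcal S},\boldsymbol x_A)\in\mathcal P_{\rm mdm}(\mathcal S\cup\{A\})\}$ and $$\underline r(A)=\inf_{\boldsymbol x_A\in\mathcal U_A}\sum_{i\in A}r_ix_{i,A},\qquad \bar r(A)=\sup_{\boldsymbol x_A\in\mathcal U_A}\sum_{i\in A}r_ix_{i,A}.$$ Then $\mathcal U_A$ is nonempty, both values are finite, and for every $\epsilon$ with $0<\epsilon<1/(2|\mathcal S|)$ (every $\epsilon>0$ if $\mathcal S=\emptyset$), $\underline r(A)$ equals the optimal value, which is attained, of the mixed integer linear program in the variables $x_{i,A}$ $(i\in A)$, $\lambda_S$ $(S\in\mathcal S)$, $\lambda_A$, $\delta_{A,S},\delta_{S,A}$ $(S\in\mathcal S)$: $$\begin{aligned} \min\ & \sum_{i\in A}r_ix_{i,A}\\ \text{s.t. } & -\delta_{A,S}\le\lambda_A-\lambda_S\le 1-(1+\epsilon)\delta_{A,S}, && i\in A,\ (i,S)\in\mathcal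 I_{\mathcal S},\\ & -\delta_{S,A}\le\lambda_S-\lambda_A\le 1-(1+\epsilon)\delta_{S,A}, && i\in A,\ (i,S)\in\mathcal I_{\mathcal S},\\ & \delta_{A,S}-1\le x_{i,A}-p_{i,S}\le 1-\delta_{S,A}, && i\in A,\ (i,S)\in\mathcal I_{\mathcal S},\\ & -(\delta_{A,S}+\delta_{S,A})\le x_{i,A}-p_{i,S}\le\delta_{A,S}+\delta_{S,A}, && i\in A,\ (i,S)\in\mathcal I_{\mathcal S},\\ & \lambda_S-\lambda_T\ge\epsilon, && (i,S),(i,T)\in\mathcal I_{\mathcal S},\ p_{i,S}<p_{i,T},\\ & \lambda_S-\lambda_T=0, && (i,S),(i,T)\in\mathcal I_{\mathcal S},\ p_{i,S}=p_{i,T}\ne0,\\ & \textstyle\sum_{i\in A}x_{i,A}=1,\quad x_{i,A}\ge0, && i\in A,\\ & 0\le\lambda_A\le1,\quad 0\le\lambda_S\le1,\quad \delta_{A,S},\delta_{S,A}\in\{0,1\}, && S\in\mathcal S. \end{aligned}$$ Likewise, $\bar r(A)$ equals the optimal value, which is attained, of the problem of maximizing $\sum_{i\in A}r_ix_{i,A}$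 over the same constraints. -/

import Mathlib

open MeasureTheory ProbabilityTheory

noncomputable section

/-- A marginal law of a random utility term: absolutely continuous, with a distribution function
that is strictly increasing on its support, and with a finite first absolute moment. -/
structure IsMDMMarginal (μ : Measure ℝ) : Prop where
  prob : IsProbabilityMeasure μ
  absCont : μ ≪ volume
  strictMono : StrictMonoOn (cdf μ) μ.support
  integrable : Integrable (fun t : ℝ => t) μ

/-- The set of all joint laws on `ℝⁿ` with the given one-dimensional marginals. -/
def jointLaws {n : ℕ} (μ : Fin n → Measure ℝ) : Set (Measure (Fin n → ℝ)) :=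
  {θ | IsProbabilityMeasure θ ∧ ∀ i, θ.map (fun e => e i) = μ i}

/-- Expected maximal utility `𝔼_θ [max_{i ∈ S} (ν_i + ε_i)]` offered by the assortment `S`. -/
def expectedMaxUtility {n : ℕ} (ν : Fin n → ℝ) (S : Finset (Fin n)) (hS : S.Nonempty)
    (θ : Measure (Fin n → ℝ)) : ℝ :=
  ∫ e, S.sup' hS (fun i => ν i + e i) ∂θ

/-- The event that product `i` maximizes the utility over the assortment `S`. -/
def argmaxEvent {n : ℕ} (ν : Fin n → ℝ) (S : Finset (Fin n)) (i : Fin n) : Set (Fin n → ℝ) :=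
  {e | ∀ j ∈ S, ν j + e j ≤ ν i + e i}

/-- `x` (through its entries `x i`, `i ∈ S`) is the vector of choice probabilities for the
assortment `S` under the marginal distribution model with deterministic utilities `ν` and
marginals `μ`: it is evaluated under a joint law that attains the maximal expected utility among
all joint laws with the given marginals. -/
def IsMDMChoice {n : ℕ} (ν : Fin n → ℝ) (μ : Fin n → Measure ℝ) (S : Finset (Fin n))
    (x : Fin n → ℝ) : Prop :=
  ∃ hS : S.Nonempty, ∃ θ ∈ jointLaws μ, IsMaxOn (expectedMaxUtility ν S hS) (jointLaws μ) θ ∧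
    ∀ i ∈ S, x i = θ.real (argmaxEvent ν S i)

/-- The choice probability collections over the assortment collection `𝒮` that are representable
by a marginal distribution model; `p S i` is the probability of choosing `i` out of `S`, and only
the entries with `S ∈ 𝒮`, `i ∈ S` matter. A single pair `(ν, μ)` has to serve all assortments. -/
def mdmProbs {n : ℕ} (𝒮 : Finset (Finset (Fin n))) : Set (Finset (Fin n) → Fin n → ℝ) :=
  {p | ∃ (ν : Fin n → ℝ) (μ : Fin n → Measure ℝ),
    (∀ i, IsMDMMarginal (μ i)) ∧ ∀ S ∈ 𝒮, IsMDMChoice ν μ S (p S)}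

/-- The choice vectors `x_A` for a new assortment `A` that are consistent with the data `p` over
`𝒮`: the collection `(p, x_A)` over `𝒮 ∪ {A}` is representable. -/
def consistentChoices {n : ℕ} (𝒮 : Finset (Finset (Fin n))) (p : Finset (Fin n) → Fin n → ℝ)
    (A : Finset (Fin n)) : Set (Fin n → ℝ) :=
  {x | Function.update p A x ∈ mdmProbs (insert A 𝒮)}

/-- Expected revenue of the assortment `A` under the choice vector `x`. -/
def revenue {n : ℕ} (r : Fin n → ℝ) (A : Finset (Fin n)) (x : Fin n → ℝ) : ℝ :=
  ∑ i ∈ A, r i * x i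

/-- The expected revenues of `A` that are consistent with the data. -/
def consistentRevenues {n : ℕ} (𝒮 : Finset (Finset (Fin n))) (p : Finset (Fin n) → Fin n → ℝ)
    (A : Finset (Fin n)) (r : Fin n → ℝ) : Set ℝ :=
  revenue r A '' consistentChoices 𝒮 p A

/-- Worst-case expected revenue. -/
def worstCaseRevenue {n : ℕ} (𝒮 : Finset (Finset (Fin n))) (p : Finset (Fin n) → Fin n → ℝ)
    (A : Finset (Fin n)) (r : Fin n → ℝ) : ℝ :=
  sInf (consistentRevenues 𝒮 p A r)

/-- Optimistic expected revenue. -/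
def optimisticRevenue {n : ℕ} (𝒮 : Finset (Finset (Fin n))) (p : Finset (Fin n) → Fin n → ℝ)
    (A : Finset (Fin n)) (r : Fin n → ℝ) : ℝ :=
  sSup (consistentRevenues 𝒮 p A r)

/-- Variables of the mixed integer linear program: `x i` for `i ∈ A`, `lam S` for
`S ∈ 𝒮 ∪ {A}`, and the binary variables `dAS S` (for `δ_{A,S}`) and `dSA S` (for `δ_{S,A}`),
`S ∈ 𝒮`. Entries with other indices occur neither in the constraints nor in the objective. -/
structure MILPVars (n : ℕ) where
  x : Fin n → ℝ
  lam : Finset (Fin n) → ℝ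
  dAS : Finset (Fin n) → ℝ
  dSA : Finset (Fin n) → ℝ

/-- The constraints of the mixed integer linear program. -/
structure MILPFeasible {n : ℕ} (𝒮 : Finset (Finset (Fin n))) (p : Finset (Fin n) → Fin n → ℝ)
    (A : Finset (Fin n)) (ε : ℝ) (v : MILPVars n) : Prop where
  sign_AS : ∀ S ∈ 𝒮, ∀ i ∈ A, i ∈ S →
    -v.dAS S ≤ v.lam A - v.lam S ∧ v.lam A - v.lam S ≤ 1 - (1 + ε) * v.dAS S
  sign_SA : ∀ S ∈ 𝒮, ∀ i ∈ A, i ∈ S →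
    -v.dSA S ≤ v.lam S - v.lam A ∧ v.lam S - v.lam A ≤ 1 - (1 + ε) * v.dSA S
  prob_order : ∀ S ∈ 𝒮, ∀ i ∈ A, i ∈ S →
    v.dAS S - 1 ≤ v.x i - p S i ∧ v.x i - p S i ≤ 1 - v.dSA S
  prob_tie : ∀ S ∈ 𝒮, ∀ i ∈ A, i ∈ S →
    -(v.dAS S + v.dSA S) ≤ v.x i - p S i ∧ v.x i - p S i ≤ v.dAS S + v.dSA S
  data_lt : ∀ S ∈ 𝒮, ∀ T ∈ 𝒮, ∀ i ∈ S, i ∈ T → p S i < p T i → ε ≤ v.lam S - v.lam T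
  data_eq : ∀ S ∈ 𝒮, ∀ T ∈ 𝒮, ∀ i ∈ S, i ∈ T → p S i = p T i → p S i ≠ 0 →
    v.lam S - v.lam T = 0
  sum_one : ∑ i ∈ A, v.x i = 1
  x_nonneg : ∀ i ∈ A, 0 ≤ v.x i
  lam_A : 0 ≤ v.lam A ∧ v.lam A ≤ 1
  lam_S : ∀ S ∈ 𝒮, 0 ≤ v.lam S ∧ v.lam S ≤ 1
  binary : ∀ S ∈ 𝒮, (v.dAS S = 0 ∨ v.dAS S = 1) ∧ (v.dSA S = 0 ∨ v.dSA S = 1)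

/-- The objective values of the feasible points of the mixed integer linear program. -/
def milpValues {n : ℕ} (𝒮 : Finset (Finset (Fin n))) (p : Finset (Fin n) → Fin n → ℝ)
    (A : Finset (Fin n)) (r : Fin n → ℝ) (ε : ℝ) : Set ℝ :=
  (fun v : MILPVars n => revenue r A v.x) '' {v | MILPFeasible 𝒮 p A ε v}

end

noncomputable section

open Filter Topology Set
open scoped NNReal

/-! For any threshold `l`, the maximum of the utilities over `S` is at most `l + ∑ (u_j - l)⁺`, and
the expectation of this bound sees only the marginals. If the survival probabilities at `l` sum to
one over `S`, a joint law under which exactly one product of `S` exceeds `l` attains the bound.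
Every optimal law then has equality almost surely, so its choice probabilities are the survival
probabilities at `l` (`measureReal_argmaxEvent`).

Hence a representable collection carries thresholds ordered oppositely to the probabilities of each
common product, with equal thresholds for equal nonzero probabilities
(`mdmProbs.exists_orderCompatible`). Conversely, such thresholds give, for each product, finitely
many points that lie on the survival function of an admissible marginal
(`SurvivalData.exists_marginal`). The variables `lam` are such thresholds, and the binaries record
how `lam A` compares with `lam S`.

The program relaxes the condition on the new assortment: where `lam A` and `lam S` differ it asks
only for weak inequalities between `x i` and `p S i`, so feasible vectors are merely limits of
consistent ones. Consistent vectors are feasible because thresholds matter only through their order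
and can be replaced by ranks in `[0, 1]` (`exists_feasible_of_consistent`). In the other direction,
a feasible `x` is mixed slightly with the values at `lam A` of marginals fitted to the data; this
removes the forbidden ties, a new fit goes through the mixed point, and a small shift of the
threshold restores total mass one (`exists_consistentChoice_near`). The set of feasible values thus
lies between the consistent revenues and their closure, and compactness makes the extrema attained.
-/

/-- The probability that the utility `ν + e` exceeds the threshold `t`. -/
def survival (ν : ℝ) (μ : Measure ℝ) (t : ℝ) : ℝ := μ.real {e | t < ν + e}

lemma measurableSet_exceed (ν t : ℝ) : MeasurableSet {e : ℝ | t < ν + e} :=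
  measurableSet_lt measurable_const (by fun_prop)

lemma survival_eq_one_sub_cdf (ν : ℝ) (μ : Measure ℝ) [IsProbabilityMeasure μ] (t : ℝ) :
    survival ν μ t = 1 - cdf μ (t - ν) := by
  have h : {e : ℝ | t < ν + e} = (Iic (t - ν))ᶜ := by
    ext e; simp [sub_lt_iff_lt_add']
  rw [survival, h, probReal_compl_eq_one_sub measurableSet_Iic, cdf_eq_real]

lemma continuous_cdf (μ : Measure ℝ) [IsProbabilityMeasure μ] [NullSingletonClass μ] :
    Continuous (cdf μ) := by
  rw [continuous_iff_continuousAt]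
  intro a
  rw [(monotone_cdf μ).continuousAt_iff_leftLim_eq_rightLim, StieltjesFunction.rightLim_eq]
  have h := (cdf μ).measure_singleton a
  rw [measure_cdf, measure_singleton] at h
  have h1 := ENNReal.ofReal_eq_zero.1 h.symm
  have h2 := (monotone_cdf μ).leftLim_le (le_refl a)
  linarith

/-! ### Regularity and flat pieces of survival functions. -/

namespace IsMDMMarginal

variable {μ : Measure ℝ}

lemma nullSingletonClass (h : IsMDMMarginal μ) : NullSingletonClass μ :=
  ⟨fun x => h.absCont (by simp)⟩

lemma continuous_survival (h : IsMDMMarginal μ) (ν : ℝ) : Continuous (survival ν μ) := by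
  have := h.prob
  have := h.nullSingletonClass
  have : survival ν μ = fun t => 1 - cdf μ (t - ν) := funext (survival_eq_one_sub_cdf ν μ)
  rw [this]
  exact continuous_const.sub ((continuous_cdf μ).comp (continuous_id.sub continuous_const))

lemma antitone_survival (h : IsMDMMarginal μ) (ν : ℝ) : Antitone (survival ν μ) := by
  have := h.prob
  intro a b hab
  rw [survival_eq_one_sub_cdf, survival_eq_one_sub_cdf]
  have := monotone_cdf μ (sub_le_sub_right hab ν)
  linarith

lemma survival_nonneg (_h : IsMDMMarginal μ) (ν t : ℝ) : 0 ≤ survival ν μ t :=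
  measureReal_nonneg

lemma survival_le_one (h : IsMDMMarginal μ) (ν t : ℝ) : survival ν μ t ≤ 1 :=
  have := h.prob
  measureReal_le_one

lemma tendsto_survival_atBot (h : IsMDMMarginal μ) (ν : ℝ) :
    Tendsto (survival ν μ) atBot (𝓝 1) := by
  have := h.prob
  have h1 : survival ν μ = fun t => 1 - cdf μ (t - ν) := funext (survival_eq_one_sub_cdf ν μ)
  rw [h1]
  have h2 : Tendsto (fun t : ℝ => t - ν) atBot atBot :=
    tendsto_atBot_add_const_right _ (-ν) tendsto_id
  simpa using tendsto_const_nhds.sub ((tendsto_cdf_atBot μ).comp h2)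

lemma tendsto_survival_atTop (h : IsMDMMarginal μ) (ν : ℝ) :
    Tendsto (survival ν μ) atTop (𝓝 0) := by
  have := h.prob
  have h1 : survival ν μ = fun t => 1 - cdf μ (t - ν) := funext (survival_eq_one_sub_cdf ν μ)
  rw [h1]
  have h2 : Tendsto (fun t : ℝ => t - ν) atTop atTop :=
    tendsto_atTop_add_const_right _ (-ν) tendsto_id
  simpa using (tendsto_const_nhds (x := (1 : ℝ))).sub ((tendsto_cdf_atTop μ).comp h2)

/-- The distribution function can only be flat at the levels `0` and `1`. -/
lemma cdf_flat (h : IsMDMMarginal μ) {a b : ℝ} (hab : a < b) (heq : cdf μ a = cdf μ b) :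
    cdf μ b = 0 ∨ cdf μ b = 1 := by
  have := h.prob
  have := h.nullSingletonClass
  by_contra! hc
  obtain ⟨h0, h1⟩ := hc
  have hsupp : μ μ.supportᶜ = 0 := Measure.measure_compl_support
  have hpos : ∀ s : Set ℝ, μ s ≠ 0 → (μ.support ∩ s).Nonempty := by
    intro s hs
    by_contra hne
    rw [not_nonempty_iff_eq_empty, ← disjoint_iff_inter_eq_empty] at hne
    exact hs (measure_mono_null (hne.symm.subset_compl_right) hsupp)
  have hcdf : ∀ x, ENNReal.ofReal (cdf μ x) = μ (Iic x) := ofReal_cdf μ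
  have hIoc : ∀ x y, μ (Ioc x y) = ENNReal.ofReal (cdf μ y - cdf μ x) := by
    intro x y
    conv_lhs => rw [← measure_cdf μ]
    exact (cdf μ).measure_Ioc x y
  have hnull : ∀ x y, x ≤ y → μ (Ioc x y) = 0 → cdf μ x = cdf μ y := by
    intro x y hxy hz
    rw [hIoc] at hz
    have := ENNReal.ofReal_eq_zero.1 hz
    have := monotone_cdf μ hxy
    linarith
  -- Mass on both sides of the flat piece gives a last support point `a'` up to `a` and a first one
  -- `b'` from `b` on. No mass lies between them, against strict monotonicity on the support.
  have hne1 : (μ.support ∩ Iic a).Nonempty := by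
    apply hpos
    rw [← hcdf, heq]
    simpa using lt_of_le_of_ne (cdf_nonneg μ b) (Ne.symm h0)
  have hne2 : (μ.support ∩ Ici b).Nonempty := by
    apply hpos
    intro hz
    apply h1
    have hz' : μ.real (Iic b)ᶜ = 0 := by
      rw [compl_Iic, measureReal_def, measure_mono_null Ioi_subset_Ici_self hz]; rfl
    rw [probReal_compl_eq_one_sub measurableSet_Iic, ← cdf_eq_real] at hz'
    linarith
  have hbdd1 : BddAbove (μ.support ∩ Iic a) := ⟨a, fun x hx => hx.2⟩
  have hbdd2 : BddBelow (μ.support ∩ Ici b) := ⟨b, fun x hx => hx.2⟩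
  have hm1 := (Measure.isClosed_support.inter isClosed_Iic).csSup_mem hne1 hbdd1
  have hm2 := (Measure.isClosed_support.inter isClosed_Ici).csInf_mem hne2 hbdd2
  set a' := sSup (μ.support ∩ Iic a)
  set b' := sInf (μ.support ∩ Ici b)
  have hlt : a' < b' := (hm1.2.trans_lt hab).trans_le hm2.2
  have e1 : cdf μ a' = cdf μ a := by
    refine hnull _ _ hm1.2 (measure_mono_null (fun x hx => ?_) hsupp)
    intro hxs
    exact absurd (le_csSup hbdd1 ⟨hxs, hx.2⟩) (not_le.2 hx.1)
  have e2 : cdf μ b = cdf μ b' := by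
    refine hnull _ _ hm2.2 (measure_mono_null (t := μ.supportᶜ ∪ {b'}) (fun x hx => ?_) ?_)
    · by_cases hxs : x ∈ μ.support
      · right
        exact le_antisymm hx.2 (csInf_le hbdd2 ⟨hxs, hx.1.le⟩)
      · exact Or.inl hxs
    · exact measure_union_null hsupp (measure_singleton b')
  have := h.strictMono hm1.1 hm2.1 hlt
  linarith

lemma survival_flat (h : IsMDMMarginal μ) (ν : ℝ) {a b : ℝ} (hab : a < b)
    (heq : survival ν μ a = survival ν μ b) : survival ν μ b = 0 ∨ survival ν μ b = 1 := by
  have := h.prob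
  rw [survival_eq_one_sub_cdf, survival_eq_one_sub_cdf] at heq
  rw [survival_eq_one_sub_cdf]
  rcases h.cdf_flat (sub_lt_sub_right hab ν) (by linarith) with h0 | h1
  · right; linarith
  · left; linarith

end IsMDMMarginal

section Threshold

/-! A deterministic view: `l + ∑ (u j - l)⁺` bounds the maximum of `u` from above. -/

variable {ι : Type*} {S : Finset ι} {u : ι → ℝ} {l : ℝ}

lemma sup'_le_add_sum_posPart (hS : S.Nonempty) (u : ι → ℝ) (l : ℝ) :
    S.sup' hS u ≤ l + ∑ j ∈ S, max (u j - l) 0 := by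
  refine Finset.sup'_le hS _ fun i hi => ?_
  have := Finset.single_le_sum (f := fun j => max (u j - l) 0) (fun j _ => le_max_right _ _) hi
  have h2 := le_max_left (u i - l) 0
  linarith

lemma sup'_eq_of_unique_exceed (hS : S.Nonempty) {i : ι} (hi : i ∈ S) (hil : l < u i)
    (hne : ∀ j ∈ S, j ≠ i → u j ≤ l) : S.sup' hS u = l + ∑ j ∈ S, max (u j - l) 0 := by
  have h1 : ∑ j ∈ S, max (u j - l) 0 = max (u i - l) 0 :=
    Finset.sum_eq_single_of_mem i hi fun j hj hji =>
      max_eq_right (sub_nonpos.2 (hne j hj hji))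
  refine le_antisymm (sup'_le_add_sum_posPart hS u l) ?_
  rw [h1, max_eq_left (by linarith)]
  linarith [Finset.le_sup' u hi]

/-- Equality forbids two utilities above `l`, since their excesses would add up to more than that of
the maximum alone. The hypothesis `u i ≠ l` excludes a tie at the threshold. -/
lemma argmax_iff_exceed (hS : S.Nonempty) (heq : S.sup' hS u = l + ∑ j ∈ S, max (u j - l) 0)
    {i : ι} (hi : i ∈ S) (hne : u i ≠ l) : (∀ j ∈ S, u j ≤ u i) ↔ l < u i := by
  classical
  constructor
  · intro h
    have h1 : S.sup' hS u ≤ u i := Finset.sup'_le hS _ h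
    have h2 : 0 ≤ ∑ j ∈ S, max (u j - l) 0 := Finset.sum_nonneg fun j _ => le_max_right _ _
    exact lt_of_le_of_ne (by linarith) hne.symm
  · intro h
    obtain ⟨k, hk, hku⟩ := Finset.exists_mem_eq_sup' hS u
    have hki : k = i := by
      by_contra hki
      have h1 : max (u k - l) 0 + max (u i - l) 0 ≤ ∑ j ∈ S, max (u j - l) 0 := by
        rw [← Finset.sum_pair (f := fun j => max (u j - l) 0) hki]
        refine Finset.sum_le_sum_of_subset_of_nonneg ?_ fun j _ _ => le_max_right _ _
        intro j hj
        simp only [Finset.mem_insert, Finset.mem_singleton] at hj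
        rcases hj with rfl | rfl <;> assumption
      have h2 := le_max_left (u k - l) 0
      have h3 := le_max_left (u i - l) 0
      linarith
    intro j hj
    rw [← hki, ← hku]
    exact Finset.le_sup' u hj

end Threshold

/-! ### A joint law attaining the dual bound. -/

section Mixture

variable {n : ℕ} (ν : Fin n → ℝ) (μ : Fin n → Measure ℝ) (S : Finset (Fin n)) (l : ℝ)

/-- The marginals conditioned on product `i` being the only one of `S` whose utility exceeds
the threshold `l`. -/
def exceedMarginals (i j : Fin n) : Measure ℝ :=
  if j = i then (μ j)[|{e | l < ν j + e}]
  else if j ∈ S then (μ j)[|{e | l < ν j + e}ᶜ] else μ j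

/-- The mixture of the product laws under which exactly one product of `S` exceeds `l`. -/
def exceedLaw : Measure (Fin n → ℝ) :=
  ∑ i ∈ S, μ i {e | l < ν i + e} • Measure.pi (exceedMarginals ν μ S l i)

variable {ν μ S l}

lemma measure_smul_cond {α : Type*} [MeasurableSpace α] (κ : Measure α) [IsFiniteMeasure κ]
    (s t : Set α) : κ s * κ[|s] t = κ.restrict s t := by
  by_cases h : κ s = 0
  · rw [h, zero_mul, Measure.restrict_eq_zero.2 h]; rfl
  · rw [ProbabilityTheory.cond, Measure.smul_apply, smul_eq_mul, ← mul_assoc,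
      ENNReal.mul_inv_cancel h (measure_ne_top _ _), one_mul]

lemma sum_measure_exceed [∀ i, IsProbabilityMeasure (μ i)]
    (hl : ∑ i ∈ S, survival (ν i) (μ i) l = 1) : ∑ i ∈ S, μ i {e | l < ν i + e} = 1 := by
  have h : ∀ i, μ i {e | l < ν i + e} = ENNReal.ofReal (survival (ν i) (μ i) l) := fun i => by
    rw [survival, ofReal_measureReal]
  simp_rw [h]
  rw [← ENNReal.ofReal_sum_of_nonneg (fun i _ => by exact measureReal_nonneg), hl, ENNReal.ofReal_one]

/-- Conditioning on `j` not exceeding `l` degenerates only if `j` exceeds surely; the total of one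
then leaves no weight for the component `i`. -/
lemma isProbabilityMeasure_exceedMarginals [∀ i, IsProbabilityMeasure (μ i)]
    (hl : ∑ i ∈ S, μ i {e | l < ν i + e} = 1) {i : Fin n} (hi : i ∈ S)
    (hpos : μ i {e | l < ν i + e} ≠ 0) (j : Fin n) :
    IsProbabilityMeasure (exceedMarginals ν μ S l i j) := by
  unfold exceedMarginals
  split_ifs with h1 h2
  · subst h1; exact cond_isProbabilityMeasure hpos
  · refine cond_isProbabilityMeasure fun h0 => hpos ?_
    have h3 : μ j {e | l < ν j + e} = 1 :=
      (prob_compl_eq_zero_iff (measurableSet_exceed (ν j) l)).1 h0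
    have h4 : ∑ k ∈ S.erase j, μ k {e | l < ν k + e} + 1 = 0 + 1 := by
      rw [zero_add, ← h3, Finset.sum_erase_add _ _ h2, hl, h3]
    have h5 := (ENNReal.add_left_inj ENNReal.one_ne_top).1 h4
    exact (Finset.sum_eq_zero_iff.1 h5) i (Finset.mem_erase.2 ⟨Ne.symm h1, hi⟩)
  · infer_instance

/-- Law of total probability: component `k` has the weight of the event that `k` exceeds `l`, and as
the weights sum to one, the others together have the weight of its complement. -/
lemma exceedLaw_eval [∀ i, IsProbabilityMeasure (μ i)]
    (hl : ∑ i ∈ S, μ i {e | l < ν i + e} = 1) (k : Fin n) :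
    (exceedLaw ν μ S l).map (fun e => e k) = μ k := by
  ext s hs
  rw [Measure.map_apply (measurable_pi_apply k) hs, exceedLaw, Measure.finsetSum_apply]
  have h1 : ∀ i ∈ S, (μ i {e | l < ν i + e} • Measure.pi (exceedMarginals ν μ S l i))
      ((fun e : Fin n → ℝ => e k) ⁻¹' s)
        = μ i {e | l < ν i + e} * exceedMarginals ν μ S l i k s := by
    intro i hi
    rw [Measure.smul_apply, smul_eq_mul]
    by_cases hpos : μ i {e | l < ν i + e} = 0
    · rw [hpos, zero_mul, zero_mul]
    · have := isProbabilityMeasure_exceedMarginals hl hi hpos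
      congr 1
      exact (measurePreserving_eval (exceedMarginals ν μ S l i) k).measure_preimage
        hs.nullMeasurableSet
  rw [Finset.sum_congr rfl h1]
  by_cases hk : k ∈ S
  · rw [← Finset.add_sum_erase _ _ hk]
    have h2 : ∀ i ∈ S.erase k, μ i {e | l < ν i + e} * exceedMarginals ν μ S l i k s
        = μ i {e | l < ν i + e} * (μ k)[|{e | l < ν k + e}ᶜ] s := by
      intro i hi
      rw [exceedMarginals, if_neg (Finset.ne_of_mem_erase hi).symm, if_pos hk]
    rw [Finset.sum_congr rfl h2, ← Finset.sum_mul]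
    have h3 : ∑ i ∈ S.erase k, μ i {e | l < ν i + e} = μ k {e | l < ν k + e}ᶜ := by
      rw [prob_compl_eq_one_sub (measurableSet_exceed (ν k) l), ← hl,
        ← Finset.add_sum_erase _ _ hk, ENNReal.add_sub_cancel_left (measure_ne_top _ _)]
    rw [h3, exceedMarginals, if_pos rfl, measure_smul_cond, measure_smul_cond,
      ← Measure.add_apply, Measure.restrict_add_restrict_compl (measurableSet_exceed (ν k) l)]
  · have h2 : ∀ i ∈ S, μ i {e | l < ν i + e} * exceedMarginals ν μ S l i k s
        = μ i {e | l < ν i + e} * μ k s := by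
      intro i hi
      rw [exceedMarginals, if_neg (by rintro rfl; exact hk hi), if_neg hk]
    rw [Finset.sum_congr rfl h2, ← Finset.sum_mul, hl, one_mul]

lemma isProbabilityMeasure_of_map {α β : Type*} [MeasurableSpace α] [MeasurableSpace β]
    {κ : Measure α} {f : α → β} (hf : Measurable f) (h : IsProbabilityMeasure (κ.map f)) :
    IsProbabilityMeasure κ :=
  ⟨by rw [← preimage_univ (f := f), ← Measure.map_apply hf MeasurableSet.univ, measure_univ]⟩

lemma exceedLaw_mem_jointLaws [∀ i, IsProbabilityMeasure (μ i)] (hS : S.Nonempty)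
    (hl : ∑ i ∈ S, μ i {e | l < ν i + e} = 1) : exceedLaw ν μ S l ∈ jointLaws μ := by
  refine ⟨?_, exceedLaw_eval hl⟩
  obtain ⟨i, -⟩ := hS
  refine isProbabilityMeasure_of_map (measurable_pi_apply i) ?_
  rw [exceedLaw_eval hl]
  infer_instance

lemma ae_exceedLaw [∀ i, IsProbabilityMeasure (μ i)] (hS : S.Nonempty)
    (hl : ∑ i ∈ S, μ i {e | l < ν i + e} = 1) :
    ∀ᵐ e ∂(exceedLaw ν μ S l),
      S.sup' hS (fun i => ν i + e i) = l + ∑ j ∈ S, max (ν j + e j - l) 0 := by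
  rw [ae_iff, exceedLaw, Measure.finsetSum_apply]
  refine Finset.sum_eq_zero fun i hi => ?_
  rw [Measure.smul_apply, smul_eq_mul, mul_eq_zero]
  by_cases hpos : μ i {e | l < ν i + e} = 0
  · exact Or.inl hpos
  right
  have := isProbabilityMeasure_exceedMarginals hl hi hpos
  rw [← ae_iff]
  have h1 : ∀ j, ∀ᵐ e ∂(Measure.pi (exceedMarginals ν μ S l i)),
      (j = i → l < ν j + e j) ∧ (j ∈ S → j ≠ i → ν j + e j ≤ l) := by
    intro j
    have h2 : ∀ᵐ x ∂(exceedMarginals ν μ S l i j),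
        (j = i → l < ν j + x) ∧ (j ∈ S → j ≠ i → ν j + x ≤ l) := by
      unfold exceedMarginals
      split_ifs with h3 h4
      · filter_upwards [ae_cond_mem (measurableSet_exceed (ν j) l)] with x hx
        exact ⟨fun _ => hx, fun _ h => absurd h3 h⟩
      · filter_upwards [ae_cond_mem (measurableSet_exceed (ν j) l).compl] with x hx
        exact ⟨fun h => absurd h h3, fun _ _ => not_lt.1 hx⟩
      · exact ae_of_all _ fun x => ⟨fun h => absurd h h3, fun h => absurd h h4⟩
    exact (measurePreserving_eval (exceedMarginals ν μ S l i) j).quasiMeasurePreserving.ae h2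
  filter_upwards [ae_all_iff.2 h1] with e he
  exact sup'_eq_of_unique_exceed (u := fun i => ν i + e i) hS hi ((he i).1 rfl)
    fun j hj hji => (he j).2 hj hji

end Mixture

/-! ### Duality and uniqueness of the choice probabilities. -/

section Choice

variable {n : ℕ} {ν : Fin n → ℝ} {μ : Fin n → Measure ℝ} {S : Finset (Fin n)} {l : ℝ}
  {θ : Measure (Fin n → ℝ)}

lemma integrable_eval (hμ : ∀ i, IsMDMMarginal (μ i)) (hθ : θ ∈ jointLaws μ) (i : Fin n) :
    Integrable (fun e => e i) θ := by
  have h := (hμ i).integrable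
  rw [← hθ.2 i] at h
  exact h.comp_measurable (measurable_pi_apply i)

lemma integrable_utility (hμ : ∀ i, IsMDMMarginal (μ i)) (hθ : θ ∈ jointLaws μ) (i : Fin n) :
    Integrable (fun e => ν i + e i) θ :=
  have := hθ.1
  (integrable_const _).add (integrable_eval hμ hθ i)

lemma integrable_posPart (hμ : ∀ i, IsMDMMarginal (μ i)) (hθ : θ ∈ jointLaws μ) (i : Fin n) :
    Integrable (fun e => max (ν i + e i - l) 0) θ :=
  have := hθ.1
  ((integrable_utility hμ hθ i).sub (integrable_const l)).pos_part

lemma integrable_sup' (hμ : ∀ i, IsMDMMarginal (μ i)) (hθ : θ ∈ jointLaws μ)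
    (hS : S.Nonempty) : Integrable (fun e => S.sup' hS (fun i => ν i + e i)) θ := by
  have h : Integrable (S.sup' hS (fun i (e : Fin n → ℝ) => ν i + e i)) θ := by
    refine Finset.sup'_induction hS _ (p := fun f => Integrable f θ) ?_ ?_
    · exact fun f hf g hg => hf.sup hg
    · exact fun i _ => integrable_utility hμ hθ i
  refine h.congr (ae_of_all _ fun e => ?_)
  simp [Finset.sup'_apply]

lemma integrable_dual (hμ : ∀ i, IsMDMMarginal (μ i)) (hθ : θ ∈ jointLaws μ) :
    Integrable (fun e => l + ∑ j ∈ S, max (ν j + e j - l) 0) θ :=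
  have := hθ.1
  (integrable_const _).add (integrable_finsetSum _ fun i _ => integrable_posPart hμ hθ i)

/-- The dual bound depends on the joint law only through its marginals. -/
lemma integral_dual (hμ : ∀ i, IsMDMMarginal (μ i)) (hθ : θ ∈ jointLaws μ) :
    ∫ e, (l + ∑ j ∈ S, max (ν j + e j - l) 0) ∂θ
      = l + ∑ j ∈ S, ∫ t, max (ν j + t - l) 0 ∂(μ j) := by
  have := hθ.1
  rw [integral_add (integrable_const _)
    (integrable_finsetSum _ fun i _ => integrable_posPart hμ hθ i), integral_const,
    integral_finsetSum _ fun i _ => integrable_posPart hμ hθ i]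
  congr 1
  · simp
  · refine Finset.sum_congr rfl fun j _ => ?_
    rw [← hθ.2 j, integral_map (measurable_pi_apply j).aemeasurable]
    exact (by fun_prop : Continuous fun t : ℝ => max (ν j + t - l) 0).aestronglyMeasurable

lemma expectedMaxUtility_le (hμ : ∀ i, IsMDMMarginal (μ i)) (hθ : θ ∈ jointLaws μ)
    (hS : S.Nonempty) (l : ℝ) :
    expectedMaxUtility ν S hS θ ≤ l + ∑ j ∈ S, ∫ t, max (ν j + t - l) 0 ∂(μ j) := by
  rw [← integral_dual hμ hθ]
  exact integral_mono (integrable_sup' hμ hθ hS) (integrable_dual hμ hθ)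
    fun e => sup'_le_add_sum_posPart hS _ l

lemma expectedMaxUtility_exceedLaw (hμ : ∀ i, IsMDMMarginal (μ i)) (hS : S.Nonempty)
    (hl : ∑ i ∈ S, survival (ν i) (μ i) l = 1) :
    expectedMaxUtility ν S hS (exceedLaw ν μ S l)
      = l + ∑ j ∈ S, ∫ t, max (ν j + t - l) 0 ∂(μ j) := by
  have := fun i => (hμ i).prob
  have hl' := sum_measure_exceed hl
  rw [← integral_dual hμ (exceedLaw_mem_jointLaws hS hl')]
  exact integral_congr_ae (ae_exceedLaw hS hl')

/-- At a threshold where the survival probabilities sum to one, they are the choice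
probabilities under every optimal joint law. -/
lemma measureReal_argmaxEvent (hμ : ∀ i, IsMDMMarginal (μ i)) (hS : S.Nonempty)
    (hl : ∑ i ∈ S, survival (ν i) (μ i) l = 1) (hθ : θ ∈ jointLaws μ)
    (hmax : IsMaxOn (expectedMaxUtility ν S hS) (jointLaws μ) θ) {i : Fin n} (hi : i ∈ S) :
    θ.real (argmaxEvent ν S i) = survival (ν i) (μ i) l := by
  have := fun i => (hμ i).prob
  have := hθ.1
  -- Optimality of `θ` closes the duality gap, so the pointwise bound is an equality almost
  -- everywhere.
  have h1 : ∫ e, S.sup' hS (fun i => ν i + e i) ∂θ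
      = ∫ e, (l + ∑ j ∈ S, max (ν j + e j - l) 0) ∂θ := by
    refine le_antisymm ?_ ?_
    · rw [integral_dual hμ hθ]
      exact expectedMaxUtility_le hμ hθ hS l
    · rw [integral_dual hμ hθ, ← expectedMaxUtility_exceedLaw hμ hS hl]
      exact hmax (exceedLaw_mem_jointLaws hS (sum_measure_exceed hl))
  have h2 := (integral_eq_iff_of_ae_le (integrable_sup' hμ hθ hS) (integrable_dual hμ hθ)
    (ae_of_all _ fun e => sup'_le_add_sum_posPart hS (fun i => ν i + e i) l)).1 h1
  have h3 : ∀ᵐ e ∂θ, ν i + e i ≠ l := by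
    have h4 : ∀ᵐ x ∂(θ.map fun e => e i), ν i + x ≠ l := by
      rw [hθ.2 i]
      have := (hμ i).nullSingletonClass
      filter_upwards [compl_mem_ae_iff.2 (measure_singleton (μ := μ i) (l - ν i))] with x hx hxl
      exact hx (by simp [← hxl])
    exact ae_of_ae_map (measurable_pi_apply i).aemeasurable h4
  have h5 : argmaxEvent ν S i =ᵐ[θ] (fun e => e i) ⁻¹' {x | l < ν i + x} := by
    filter_upwards [h2, h3] with e he1 he2
    exact propext (argmax_iff_exceed (u := fun i => ν i + e i) hS he1 hi he2)
  rw [survival, ← hθ.2 i, measureReal_def, measureReal_def, measure_congr h5,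
    Measure.map_apply (measurable_pi_apply i) (measurableSet_exceed (ν i) l)]

lemma isMDMChoice_of_survival (hμ : ∀ i, IsMDMMarginal (μ i)) (hS : S.Nonempty)
    (hl : ∑ i ∈ S, survival (ν i) (μ i) l = 1) {x : Fin n → ℝ}
    (hx : ∀ i ∈ S, x i = survival (ν i) (μ i) l) : IsMDMChoice ν μ S x := by
  have := fun i => (hμ i).prob
  have hmem := exceedLaw_mem_jointLaws hS (sum_measure_exceed hl)
  have hmax : IsMaxOn (expectedMaxUtility ν S hS) (jointLaws μ) (exceedLaw ν μ S l) := by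
    intro θ hθ
    rw [mem_ofPred_eq, expectedMaxUtility_exceedLaw hμ hS hl]
    exact expectedMaxUtility_le hμ hθ hS l
  exact ⟨hS, _, hmem, hmax, fun i hi => by
    rw [hx i hi, measureReal_argmaxEvent hμ hS hl hmem hmax hi]⟩

end Choice

/-! ### From a model to ordered thresholds. -/

section Necessity

variable {n : ℕ} {ν : Fin n → ℝ} {μ : Fin n → Measure ℝ} {S : Finset (Fin n)}

lemma continuous_sum_survival (hμ : ∀ i, IsMDMMarginal (μ i)) :
    Continuous fun t => ∑ i ∈ S, survival (ν i) (μ i) t :=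
  continuous_finsetSum _ fun i _ => (hμ i).continuous_survival (ν i)

lemma antitone_sum_survival (hμ : ∀ i, IsMDMMarginal (μ i)) :
    Antitone fun t => ∑ i ∈ S, survival (ν i) (μ i) t :=
  fun _ _ h => Finset.sum_le_sum fun i _ => (hμ i).antitone_survival (ν i) h

/-- Survival probability at a threshold that may be `-∞`. -/
def survivalBot (ν : ℝ) (μ : Measure ℝ) : WithBot ℝ → ℝ :=
  WithBot.recBotCoe 1 (survival ν μ)

@[simp] lemma survivalBot_bot (ν : ℝ) (μ : Measure ℝ) : survivalBot ν μ ⊥ = 1 := rfl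

@[simp] lemma survivalBot_coe (ν : ℝ) (μ : Measure ℝ) (t : ℝ) :
    survivalBot ν μ t = survival ν μ t := rfl

lemma antitone_survivalBot {μ : Measure ℝ} (h : IsMDMMarginal μ) (ν : ℝ) :
    Antitone (survivalBot ν μ) := by
  intro a b hab
  induction b using WithBot.recBotCoe with
  | bot => rw [le_bot_iff.1 hab]
  | coe b =>
    induction a using WithBot.recBotCoe with
    | bot => exact h.survival_le_one ν b
    | coe a => exact h.antitone_survival ν (WithBot.coe_le_coe.1 hab)

lemma survivalBot_flat {μ : Measure ℝ} (h : IsMDMMarginal μ) (ν : ℝ) {a : WithBot ℝ} {b : ℝ}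
    (hab : a < b) (heq : survivalBot ν μ a = survival ν μ b) :
    survival ν μ b = 0 ∨ survival ν μ b = 1 := by
  induction a using WithBot.recBotCoe with
  | bot => exact Or.inr heq.symm
  | coe a => exact h.survival_flat ν (WithBot.coe_lt_coe.1 hab) heq

/-- The choice probabilities of an assortment are survival probabilities at the largest
threshold at which they sum to at least one. -/
lemma IsMDMChoice.exists_threshold (hμ : ∀ i, IsMDMMarginal (μ i)) {x : Fin n → ℝ}
    (hx : IsMDMChoice ν μ S x) :
    ∃ l : WithBot ℝ, (∀ i ∈ S, x i = survivalBot (ν i) (μ i) l) ∧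
      (∀ t : ℝ, 1 ≤ ∑ i ∈ S, survival (ν i) (μ i) t → (t : WithBot ℝ) ≤ l) ∧
      ∑ i ∈ S, x i = 1 := by
  obtain ⟨hS, θ, hθ, hmax, hxθ⟩ := hx
  have := hθ.1
  have hcont := continuous_sum_survival (ν := ν) (S := S) hμ
  have hanti := antitone_sum_survival (ν := ν) (S := S) hμ
  set G : ℝ → ℝ := fun t => ∑ i ∈ S, survival (ν i) (μ i) t with hG
  have hbot : Tendsto G atBot (𝓝 (S.card : ℝ)) := by
    have := tendsto_finsetSum S fun i _ => (hμ i).tendsto_survival_atBot (ν i)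
    simpa using this
  have htop : Tendsto G atTop (𝓝 0) := by
    have := tendsto_finsetSum S fun i _ => (hμ i).tendsto_survival_atTop (ν i)
    simpa using this
  by_cases hne : {t | 1 ≤ G t}.Nonempty
  · obtain ⟨b, hb⟩ := (htop.eventually (gt_mem_nhds zero_lt_one)).exists
    have hbdd : BddAbove {t | 1 ≤ G t} := by
      refine ⟨b, fun t ht => ?_⟩
      by_contra! hbt
      have h1 : (1 : ℝ) ≤ G t := ht
      linarith [hanti hbt.le]
    have hcl : IsClosed {t | 1 ≤ G t} := isClosed_le continuous_const hcont
    have hmem : 1 ≤ G (sSup {t | 1 ≤ G t}) := hcl.csSup_mem hne hbdd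
    set l := sSup {t | 1 ≤ G t} with hl
    have hl1 : G l = 1 := by
      refine le_antisymm ?_ hmem
      by_contra! hgt
      obtain ⟨t, hlt, ht⟩ := (((hcont.tendsto l).eventually (lt_mem_nhds hgt)).filter_mono
        nhdsWithin_le_nhds |>.and (self_mem_nhdsWithin (s := Ioi l))).exists
      exact absurd (le_csSup hbdd (show 1 ≤ G t from hlt.le)) (not_le.2 ht)
    refine ⟨l, fun i hi => ?_, fun t ht => WithBot.coe_le_coe.2 (le_csSup hbdd ht), ?_⟩
    · rw [hxθ i hi, measureReal_argmaxEvent hμ hS hl1 hθ hmax hi, survivalBot_coe]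
    · rw [← hl1]
      exact Finset.sum_congr rfl fun i hi => by
        rw [hxθ i hi, measureReal_argmaxEvent hμ hS hl1 hθ hmax hi]
  -- The limit `S.card` of the sum at `-∞` forces a singleton here; its product is chosen surely,
  -- with threshold `⊥`.
  · have hlt : ∀ t, G t < 1 := fun t => by
      by_contra! h
      exact hne ⟨t, h⟩
    have hcard : S.card = 1 := by
      refine le_antisymm ?_ hS.card_pos
      exact_mod_cast le_of_tendsto hbot (Eventually.of_forall fun t => (hlt t).le)
    obtain ⟨i, rfl⟩ := Finset.card_eq_one.1 hcard
    have hone : x i = 1 := by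
      rw [hxθ i (Finset.mem_singleton_self i)]
      have : argmaxEvent ν {i} i = univ := by
        ext e; simp [argmaxEvent]
      rw [this, probReal_univ]
    refine ⟨⊥, fun j hj => ?_, fun t ht => absurd (hlt t) (not_lt.2 ht), by simpa using hone⟩
    rw [Finset.mem_singleton.1 hj, hone, survivalBot_bot]

lemma IsMDMChoice.nonneg {x : Fin n → ℝ} (hx : IsMDMChoice ν μ S x) {i : Fin n} (hi : i ∈ S) :
    0 ≤ x i := by
  obtain ⟨hS, θ, hθ, hmax, hxθ⟩ := hx
  rw [hxθ i hi]
  exact measureReal_nonneg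

/-- A representable collection of choice probabilities consists of probability vectors. -/
lemma mdmProbs.simplex {𝒯 : Finset (Finset (Fin n))} {p : Finset (Fin n) → Fin n → ℝ}
    (hp : p ∈ mdmProbs 𝒯) {S : Finset (Fin n)} (hS : S ∈ 𝒯) :
    S.Nonempty ∧ (∀ i ∈ S, 0 ≤ p S i) ∧ ∑ i ∈ S, p S i = 1 := by
  obtain ⟨ν, μ, hμ, hc⟩ := hp
  obtain ⟨l, -, -, h⟩ := (hc S hS).exists_threshold hμ
  exact ⟨(hc S hS).1, fun i hi => (hc S hS).nonneg hi, h⟩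

/-- `f` orders the assortments oppositely to the choice probabilities of each common product. -/
def OrderCompatible {α : Type*} [LT α] (𝒯 : Finset (Finset (Fin n)))
    (p : Finset (Fin n) → Fin n → ℝ) (f : Finset (Fin n) → α) : Prop :=
  ∀ S ∈ 𝒯, ∀ T ∈ 𝒯, ∀ i ∈ S, i ∈ T →
    (p S i < p T i → f T < f S) ∧ (p S i = p T i → p S i ≠ 0 → f S = f T)

lemma mdmProbs.exists_orderCompatible {𝒯 : Finset (Finset (Fin n))}
    {p : Finset (Fin n) → Fin n → ℝ} (hp : p ∈ mdmProbs 𝒯) :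
    ∃ f : Finset (Fin n) → WithBot ℝ, OrderCompatible 𝒯 p f := by
  classical
  obtain ⟨ν, μ, hμ, hc⟩ := hp
  have hth := fun S (hS : S ∈ 𝒯) => (hc S hS).exists_threshold hμ
  choose! f hf using hth
  have key : ∀ S ∈ 𝒯, ∀ T ∈ 𝒯, ∀ i ∈ S, i ∈ T → p S i = p T i → p S i ≠ 0 → ¬ f S < f T := by
    intro S hS T hT i hiS hiT heq hne hlt
    have h1 := (hf S hS).1 i hiS
    have h2 := (hf T hT).1 i hiT
    obtain ⟨t, ht⟩ := WithBot.ne_bot_iff_exists.1 (bot_le.trans_lt hlt).ne'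
    rw [← ht, survivalBot_coe] at h2
    have hlt' := hlt
    rw [← ht] at hlt'
    -- Level `1` is the only possible flat level left. There the sum over `S` is still at least one
    -- at `t`, against the maximality of the threshold of `S`.
    rcases survivalBot_flat (hμ i) (ν i) hlt' (by rw [← h1, ← h2, heq]) with h0 | h0
    · exact hne (by rw [heq, h2, h0])
    · have h3 : 1 ≤ ∑ j ∈ S, survival (ν j) (μ j) t := by
        rw [← h0]
        exact Finset.single_le_sum (f := fun j => survival (ν j) (μ j) t)
          (fun j _ => (hμ j).survival_nonneg _ _) hiS
      exact absurd ((hf S hS).2.1 t h3) (not_le.2 hlt')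
  refine ⟨f, fun S hS T hT i hiS hiT => ⟨fun hlt => ?_, fun heq hne => ?_⟩⟩
  · by_contra! hle
    have := antitone_survivalBot (hμ i) (ν i) hle
    rw [← (hf S hS).1 i hiS, ← (hf T hT).1 i hiT] at this
    exact absurd hlt (not_lt.2 this)
  · exact le_antisymm (not_lt.1 (key T hT S hS i hiT hiS heq.symm (heq ▸ hne)))
      (not_lt.1 (key S hS T hT i hiS hiT heq hne))

end Necessity

/-- Finitely many levels can be placed in `[0, 1]` with gaps of prescribed size. -/
lemma exists_unitInterval_levels {ι α : Type*} [LinearOrder α] (s : Finset ι) (f : ι → α)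
    {ε : ℝ} {N : ℕ} (hN : s.card ≤ N + 1) (hε : ε * N ≤ 1) :
    ∃ h : ι → ℝ, (∀ a, 0 ≤ h a ∧ h a ≤ 1) ∧
      (∀ a ∈ s, ∀ b ∈ s, f a < f b → h a + ε ≤ h b) ∧ ∀ a b, f a = f b → h a = h b := by
  classical
  let rk : ι → ℕ := fun a => (s.filter fun c => f c < f a).card
  have hrk : ∀ a ∈ s, rk a ≤ N := by
    intro a ha
    have : rk a < s.card := Finset.card_lt_card
      ⟨Finset.filter_subset _ _, fun h => by simpa using h ha⟩
    omega
  -- The truncation matters only outside `s`, where the rank may be `N + 1`. For `N = 0` the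
  -- quotient is `0` by convention.
  refine ⟨fun a => min 1 (rk a / N), fun a => ⟨?_, min_le_left _ _⟩, ?_, ?_⟩
  · exact le_min zero_le_one (by positivity)
  · intro a ha b hb hab
    have hlt : rk a < rk b := by
      refine Finset.card_lt_card ⟨fun c hc => ?_, fun h => ?_⟩
      · rw [Finset.mem_filter] at hc ⊢
        exact ⟨hc.1, hc.2.trans hab⟩
      · have := h (Finset.mem_filter.2 ⟨ha, hab⟩)
        simp at this
    have hbN := hrk b hb
    have hNpos : (0 : ℝ) < N := by
      have : 0 < N := by omega
      exact_mod_cast this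
    have h1 : (rk a : ℝ) + 1 ≤ rk b := by exact_mod_cast hlt
    have h2 : (rk b : ℝ) ≤ N := by exact_mod_cast hbN
    have h3 : (rk b : ℝ) / N ≤ 1 := (div_le_one hNpos).2 h2
    simp only
    rw [min_eq_right h3]
    refine (add_le_add_left (min_le_right _ _) _).trans ?_
    rw [div_add' _ _ _ hNpos.ne']
    exact div_le_div_of_nonneg_right (by linarith) hNpos.le
  · intro a b hab
    simp only [rk, hab]

/-! ### Admissible marginals from functions with bounded slopes. -/

section Clamp

/-- The distribution function obtained by clamping a function to `[0, 1]`. -/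
def clampStieltjes (R : ℝ → ℝ) (hR : Monotone R) (hc : Continuous R) : StieltjesFunction ℝ where
  toFun t := max 0 (min 1 (R t))
  mono' := fun _ _ h => max_le_max le_rfl (min_le_min le_rfl (hR h))
  right_continuous' := fun _ =>
    (continuous_const.max (continuous_const.min hc)).continuousWithinAt

/-- The complement `L * t - F t` is again a Stieltjes function, so `F.measure` is a summand of `L •
volume`. -/
lemma stieltjes_absolutelyContinuous (F : StieltjesFunction ℝ) (hF : Continuous F) (L : ℝ≥0)
    (hL : ∀ s t, s ≤ t → F t - F s ≤ L * (t - s)) : F.measure ≪ volume := by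
  let H : StieltjesFunction ℝ :=
    { toFun := fun t => L * t - F t
      mono' := fun s t h => by have := hL s t h; simp only; linarith
      right_continuous' := fun _ =>
        ((continuous_const.mul continuous_id).sub hF).continuousWithinAt }
  have h1 : F + H = L • StieltjesFunction.id := by
    ext t
    have : (F + H) t = F t + (L * t - F t) := rfl
    rw [this]
    have : (L • StieltjesFunction.id) t = L * t := rfl
    rw [this]; ring
  have h2 : F.measure + H.measure = L • volume := by
    rw [← StieltjesFunction.measure_add, h1, StieltjesFunction.measure_smul,
      Real.volume_eq_stieltjes_id]
  have h3 : F.measure ≤ L • volume := by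
    rw [← h2]; exact Measure.le_add_right le_rfl
  exact h3.absolutelyContinuous.trans Measure.smul_absolutelyContinuous

/-- Clamping a function with slopes between `c > 0` and `L` gives the distribution function of
an admissible marginal. -/
lemma exists_marginal_of_slopes (raw : ℝ → ℝ) {c L : ℝ} (hc : 0 < c) (hcL : c ≤ L)
    (hslope : ∀ s t, s ≤ t → c * (t - s) ≤ raw s - raw t ∧ raw s - raw t ≤ L * (t - s)) :
    ∃ μ, IsMDMMarginal μ ∧ (∀ t, survival 0 μ t = max 0 (min 1 (raw t))) ∧
      ∃ t, survival 0 μ t = 1 := by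
  have hcont : Continuous raw := by
    refine (LipschitzWith.of_dist_le_mul (K := ⟨L, hc.le.trans hcL⟩) fun x y => ?_).continuous
    rw [Real.dist_eq, Real.dist_eq]
    change |raw x - raw y| ≤ L * |x - y|
    rcases le_total x y with h | h
    · have := hslope x y h
      rw [abs_sub_comm x y, abs_of_nonneg (sub_nonneg.2 h), abs_of_nonneg]
      · exact this.2
      · exact (mul_nonneg hc.le (sub_nonneg.2 h)).trans this.1
    · have := hslope y x h
      rw [abs_sub_comm (raw x), abs_of_nonneg (sub_nonneg.2 h), abs_of_nonneg]
      · exact this.2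
      · exact (mul_nonneg hc.le (sub_nonneg.2 h)).trans this.1
  -- The positive slope `c` drives `raw` through the levels `1` and `0`, so the law has bounded
  -- support and is integrable.
  have hlow : ∃ a, 1 ≤ raw a := by
    refine ⟨-((1 + |raw 0|) / c), ?_⟩
    have h1 : 0 ≤ (1 + |raw 0|) / c := by positivity
    have h2 := (hslope (-((1 + |raw 0|) / c)) 0 (by linarith)).1
    have h3 : c * (0 - -((1 + |raw 0|) / c)) = 1 + |raw 0| := by field_simp; ring
    linarith [neg_abs_le (raw 0)]
  have hhigh : ∃ b, raw b ≤ 0 := by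
    refine ⟨|raw 0| / c, ?_⟩
    have h1 : 0 ≤ |raw 0| / c := by positivity
    have h2 := (hslope 0 (|raw 0| / c) h1).1
    have h3 : c * (|raw 0| / c - 0) = |raw 0| := by field_simp; ring
    linarith [le_abs_self (raw 0)]
  have hlt : ∀ s t, s < t → raw t < raw s := fun s t h => by
    have := (hslope s t h.le).1
    have := mul_pos hc (sub_pos.2 h)
    linarith
  have hanti : Antitone raw := fun s t h => by
    rcases h.eq_or_lt with rfl | h
    · exact le_rfl
    · exact (hlt s t h).le
  obtain ⟨a1, ha1⟩ := hlow
  obtain ⟨b1, hb1⟩ := hhigh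
  have hivt : ∀ v, 0 ≤ v → v ≤ 1 → ∃ x, raw x = v := fun v h0 h1 =>
    mem_range_of_exists_le_of_exists_ge hcont ⟨b1, hb1.trans h0⟩ ⟨a1, h1.trans ha1⟩
  obtain ⟨a, ha⟩ := hivt 1 zero_le_one le_rfl
  obtain ⟨b, hb⟩ := hivt 0 le_rfl zero_le_one
  let F := clampStieltjes (fun t => 1 - raw t) (fun s t h => sub_le_sub_left (hanti h) 1)
    (continuous_const.sub hcont)
  have hF : ∀ t, F t = max 0 (min 1 (1 - raw t)) := fun t => rfl
  have hFa : ∀ t ≤ a, F t = 0 := fun t ht => by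
    rw [hF, max_eq_left]
    exact (min_le_right _ _).trans (by linarith [hanti ht])
  have hFb : ∀ t, b ≤ t → F t = 1 := fun t ht => by
    rw [hF, min_eq_left (by linarith [hanti ht]), max_eq_right zero_le_one]
  have hbot : Tendsto F atBot (𝓝 0) :=
    tendsto_const_nhds.congr' ((eventually_le_atBot a).mono fun t ht => (hFa t ht).symm)
  have htop : Tendsto F atTop (𝓝 1) :=
    tendsto_const_nhds.congr' ((eventually_ge_atTop b).mono fun t ht => (hFb t ht).symm)
  have hcdf : cdf F.measure = F := cdf_measure_stieltjesFunction F hbot htop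
  have hprob : IsProbabilityMeasure F.measure := F.isProbabilityMeasure hbot htop
  have hnull : F.measure (Icc a b)ᶜ = 0 := by
    refine measure_mono_null (t := Iic a ∪ Ioi b) (fun x hx => ?_) (measure_union_null ?_ ?_)
    · by_contra h
      rw [mem_union, not_or] at h
      exact hx ⟨(not_le.1 h.1).le, not_lt.1 h.2⟩
    · rw [F.measure_Iic hbot, hFa a le_rfl]; simp
    · rw [F.measure_Ioi htop, hFb b le_rfl]; simp
  have hFsub : ∀ s t, s ≤ t → F t - F s ≤ L * (t - s) := by
    intro s t h
    have h1 := (hslope s t h).2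
    have h2 : 0 ≤ L * (t - s) := mul_nonneg (hc.le.trans hcL) (sub_nonneg.2 h)
    rw [hF, hF, sub_le_iff_le_add]
    refine max_le (add_nonneg h2 (le_max_left _ _)) ?_
    rcases le_total 1 (1 - raw s) with h3 | h3
    · rw [min_eq_left h3, max_eq_right zero_le_one]
      linarith [min_le_left 1 (1 - raw t)]
    · rw [min_eq_right h3]
      linarith [min_le_right 1 (1 - raw t), le_max_right 0 (1 - raw s)]
  have hsurv : ∀ t, survival 0 F.measure t = max 0 (min 1 (raw t)) := by
    intro t
    rw [survival_eq_one_sub_cdf, hcdf, sub_zero, hF]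
    rcases le_total (raw t) 0 with h | h
    · rw [min_eq_left (by linarith), max_eq_right zero_le_one, min_eq_right (by linarith),
        max_eq_left h, sub_self]
    · rw [min_eq_right (by linarith : 1 - raw t ≤ 1)]
      rcases le_total (raw t) 1 with h' | h'
      · rw [max_eq_right (by linarith), min_eq_right h', max_eq_right h]; ring
      · rw [max_eq_left (by linarith), min_eq_left h', max_eq_right zero_le_one]; ring
  refine ⟨F.measure, ⟨hprob, ?_, ?_, ?_⟩, hsurv, a, by rw [hsurv, ha]; simp⟩
  · refine stieltjes_absolutelyContinuous F ?_ ⟨L, hc.le.trans hcL⟩ hFsub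
    exact continuous_const.max (continuous_const.min (continuous_const.sub hcont))
  · rw [hcdf]
    have hsub : F.measure.support ⊆ Icc a b :=
      Measure.support_subset_of_isClosed isClosed_Icc (mem_ae_iff.2 hnull)
    have hFR : ∀ x ∈ Icc a b, F x = 1 - raw x := fun x hx => by
      have h1 := hanti hx.1
      have h2 := hanti hx.2
      rw [hF, min_eq_right (by linarith), max_eq_right (by linarith)]
    intro s hs t ht hst
    rw [hFR s (hsub hs), hFR t (hsub ht)]
    linarith [hlt s t hst]
  · exact Integrable.of_mem_Icc a b aemeasurable_id (mem_ae_iff.2 hnull)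

end Clamp

/-! ### Interpolation of finite survival data. -/

section Interpolation

lemma Finset.exists_pos_le {α : Type*} (s : Finset α) (f : α → ℝ) :
    ∃ δ > 0, ∀ a ∈ s, 0 < f a → δ ≤ f a := by
  classical
  induction s using Finset.induction_on with
  | empty => exact ⟨1, one_pos, by simp⟩
  | insert a s _ ih =>
    obtain ⟨δ, hδ, h⟩ := ih
    by_cases ha : 0 < f a
    · refine ⟨min δ (f a), lt_min hδ ha, fun b hb hb0 => ?_⟩
      rcases Finset.mem_insert.1 hb with rfl | hb
      · exact min_le_right _ _
      · exact (min_le_left _ _).trans (h b hb hb0)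
    · refine ⟨δ, hδ, fun b hb hb0 => ?_⟩
      rcases Finset.mem_insert.1 hb with rfl | hb
      · exact absurd hb0 ha
      · exact h b hb hb0

lemma Finset.exists_pos_ge {α : Type*} (s : Finset α) (f : α → ℝ) :
    ∃ W > 0, ∀ a ∈ s, f a ≤ W := by
  classical
  obtain ⟨W, hW⟩ := (s.image f).exists_le
  exact ⟨max W 1, lt_max_of_lt_right one_pos, fun a ha =>
    (hW _ (Finset.mem_image_of_mem f ha)).trans (le_max_left _ _)⟩

/-- Pairs (threshold, probability) that lie on the graph of a common survival function. -/
def SurvivalData (D : Finset (ℝ × ℝ)) : Prop :=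
  (∀ a ∈ D, 0 ≤ a.2 ∧ a.2 ≤ 1) ∧ ∀ a ∈ D, ∀ b ∈ D,
    (a.2 < b.2 → b.1 < a.1) ∧ (a.2 = b.2 → 0 < a.2 → a.2 < 1 → a.1 = b.1)

/-- An asymmetric hinge with slopes `L` on the positive and `c` on the negative half line. -/
def hinge (c L s : ℝ) : ℝ := max (L * s) (c * s)

lemma hinge_slope {c L : ℝ} (hcL : c ≤ L) {s t : ℝ} (h : s ≤ t) :
    c * (t - s) ≤ hinge c L t - hinge c L s ∧ hinge c L t - hinge c L s ≤ L * (t - s) := by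
  have h0 : c * (t - s) ≤ L * (t - s) := mul_le_mul_of_nonneg_right hcL (sub_nonneg.2 h)
  unfold hinge
  constructor
  · have : max (L * s) (c * s) ≤ max (L * t) (c * t) - c * (t - s) := by
      refine max_le ?_ ?_
      · linarith [le_max_left (L * t) (c * t)]
      · linarith [le_max_right (L * t) (c * t)]
    linarith
  · have : max (L * t) (c * t) ≤ max (L * s) (c * s) + L * (t - s) := by
      refine max_le ?_ ?_
      · linarith [le_max_left (L * s) (c * s)]
      · linarith [le_max_right (L * s) (c * s)]
    linarith

/-- The interpolant is the lower envelope of decreasing hinges through the data points of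
probability below `1`. Several thresholds may share level `0` or `1`; there the envelope need only
be `≤ 0` or `≥ 1`, and clamping does the rest. -/
lemma SurvivalData.exists_marginal_of_lt_one {D : Finset (ℝ × ℝ)} (hD : SurvivalData D)
    (hne : ∃ a ∈ D, a.2 < 1) :
    ∃ μ, IsMDMMarginal μ ∧ (∀ a ∈ D, survival 0 μ a.1 = a.2) ∧ ∃ t, survival 0 μ t = 1 := by
  classical
  obtain ⟨h01, hord⟩ := hD
  obtain ⟨δ₁, hδ₁, hgap₁⟩ := (D ×ˢ D).exists_pos_le fun q => q.2.1 - q.1.1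
  obtain ⟨δ₂, hδ₂, hgap₂⟩ := (D ×ˢ D).exists_pos_le fun q => q.2.2 - q.1.2
  obtain ⟨W, hW, hwidth⟩ := (D ×ˢ D).exists_pos_ge fun q => q.2.1 - q.1.1
  -- Over the whole width `W`, slope `c` loses no more than the smallest probability gap; over the
  -- smallest threshold gap, slope `L` gains at least `1`. So no hinge cuts below another data point
  -- of positive probability.
  set c := δ₂ / W with hc
  set L := max (1 / δ₁) c with hL
  have hcpos : 0 < c := by positivity
  have hcL : c ≤ L := le_max_right _ _
  have hD' : (D.filter fun a => a.2 < 1).Nonempty := by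
    obtain ⟨a, ha, ha1⟩ := hne
    exact ⟨a, Finset.mem_filter.2 ⟨ha, ha1⟩⟩
  set D' := D.filter fun a => a.2 < 1
  let raw : ℝ → ℝ := fun t => D'.inf' hD' fun a => a.2 + hinge c L (a.1 - t)
  have hle : ∀ t, ∀ a ∈ D', raw t ≤ a.2 + hinge c L (a.1 - t) := fun t a ha =>
    Finset.inf'_le (fun a : ℝ × ℝ => a.2 + hinge c L (a.1 - t)) ha
  have hatt : ∀ t, ∃ a ∈ D', raw t = a.2 + hinge c L (a.1 - t) := fun t =>
    Finset.exists_mem_eq_inf' hD' fun a : ℝ × ℝ => a.2 + hinge c L (a.1 - t)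
  have hslope : ∀ s t, s ≤ t →
      c * (t - s) ≤ raw s - raw t ∧ raw s - raw t ≤ L * (t - s) := by
    intro s t h
    constructor
    · obtain ⟨a, ha, hsa⟩ := hatt s
      have h1 := hle t a ha
      have h2 := (hinge_slope hcL (sub_le_sub_left h a.1)).1
      rw [sub_sub_sub_cancel_left] at h2
      linarith
    · obtain ⟨a, ha, hta⟩ := hatt t
      have h1 := hle s a ha
      have h2 := (hinge_slope hcL (sub_le_sub_left h a.1)).2
      rw [sub_sub_sub_cancel_left] at h2
      linarith
  obtain ⟨μ, hμ, hs, h1⟩ := exists_marginal_of_slopes raw hcpos hcL hslope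
  refine ⟨μ, hμ, fun m hm => ?_, h1⟩
  obtain ⟨hm0, hm1⟩ := h01 m hm
  have hself : m.2 < 1 → raw m.1 ≤ m.2 := fun h => by
    simpa [hinge] using hle m.1 m (Finset.mem_filter.2 ⟨hm, h⟩)
  have hlower : 0 < m.2 → m.2 ≤ raw m.1 := by
    intro hpos
    refine Finset.le_inf' _ _ fun k hk => ?_
    obtain ⟨hkD, hk1⟩ := Finset.mem_filter.1 hk
    have hk0 := (h01 k hkD).1
    rcases lt_trichotomy k.2 m.2 with h | h | h
    · have hlt := (hord k hkD m hm).1 h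
      have hg := hgap₁ (m, k) (Finset.mk_mem_product hm hkD) (sub_pos.2 hlt)
      have h2 : 1 ≤ L * (k.1 - m.1) := by
        calc (1 : ℝ) = 1 / δ₁ * δ₁ := by field_simp
          _ ≤ L * (k.1 - m.1) :=
            mul_le_mul (le_max_left _ _) hg hδ₁.le (hcpos.le.trans hcL)
      have h3 : L * (k.1 - m.1) ≤ hinge c L (k.1 - m.1) := le_max_left _ _
      linarith
    · have := (hord m hm k hkD).2 h.symm hpos (h ▸ hk1)
      rw [this, sub_self, h]
      simp [hinge]
    · have hlt := (hord m hm k hkD).1 h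
      have hg := hgap₂ (m, k) (Finset.mk_mem_product hm hkD) (sub_pos.2 h)
      have hw := hwidth (k, m) (Finset.mk_mem_product hkD hm)
      have h2 : c * (m.1 - k.1) ≤ δ₂ := by
        calc c * (m.1 - k.1) ≤ c * W := mul_le_mul_of_nonneg_left hw hcpos.le
          _ = δ₂ := by rw [hc]; field_simp
      have h3 : c * (k.1 - m.1) ≤ hinge c L (k.1 - m.1) := le_max_right _ _
      simp only at hg
      linarith
  rw [hs]
  rcases hm0.eq_or_lt with h0 | h0
  · have := hself (by linarith)
    rw [← h0] at this ⊢
    exact max_eq_left ((min_le_right _ _).trans this)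
  rcases hm1.eq_or_lt with h1 | h1
  · have := hlower h0
    rw [min_eq_left (by linarith), h1, max_eq_right zero_le_one]
  · rw [le_antisymm (hself h1) (hlower h0), min_eq_right hm1, max_eq_right hm0]

/-- Every finite set of survival data is interpolated by an admissible marginal. -/
lemma SurvivalData.exists_marginal {D : Finset (ℝ × ℝ)} (hD : SurvivalData D) :
    ∃ μ, IsMDMMarginal μ ∧ (∀ a ∈ D, survival 0 μ a.1 = a.2) ∧ ∃ t, survival 0 μ t = 1 := by
  classical
  obtain ⟨W, hW, hle⟩ := D.exists_pos_ge fun a => a.1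
  -- A point of probability `0` beyond all thresholds keeps the envelope nonempty.
  have hD' : SurvivalData (insert (W + 1, 0) D) := by
    refine ⟨fun a ha => ?_, fun a ha b hb => ?_⟩
    · rcases Finset.mem_insert.1 ha with rfl | ha
      · simp
      · exact hD.1 a ha
    · rcases Finset.mem_insert.1 ha with rfl | ha <;> rcases Finset.mem_insert.1 hb with rfl | hb
      · simp
      · exact ⟨fun _ => by have := hle b hb; simp only; linarith, fun _ h => absurd h (lt_irrefl _)⟩
      · exact ⟨fun h => absurd h (not_lt.2 (hD.1 a ha).1), fun h h' => absurd h h'.ne'⟩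
      · exact hD.2 a ha b hb
  obtain ⟨μ, hμ, h, h1⟩ := hD'.exists_marginal_of_lt_one
    ⟨_, Finset.mem_insert_self _ _, zero_lt_one⟩
  exact ⟨μ, hμ, fun a ha => h a (Finset.mem_insert_of_mem ha), h1⟩

end Interpolation

/-! ### From ordered thresholds to models. -/

section Sufficiency

variable {n : ℕ} {𝒮 : Finset (Finset (Fin n))} {p : Finset (Fin n) → Fin n → ℝ}
  {A : Finset (Fin n)}

/-- The thresholds and choice probabilities observed for product `i`. -/
def productData (𝒮 : Finset (Finset (Fin n))) (p : Finset (Fin n) → Fin n → ℝ)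
    (f : Finset (Fin n) → ℝ) (i : Fin n) : Finset (ℝ × ℝ) :=
  (𝒮.filter fun S => i ∈ S).image fun S => (f S, p S i)

lemma mem_productData {f : Finset (Fin n) → ℝ} {i : Fin n} {a : ℝ × ℝ} :
    a ∈ productData 𝒮 p f i ↔ ∃ S ∈ 𝒮, i ∈ S ∧ a = (f S, p S i) := by
  simp only [productData, Finset.mem_image, Finset.mem_filter, and_assoc, eq_comm]

lemma prob_mem_unitInterval (hp : p ∈ mdmProbs 𝒮) {S : Finset (Fin n)} (hS : S ∈ 𝒮) {i : Fin n}
    (hi : i ∈ S) : 0 ≤ p S i ∧ p S i ≤ 1 := by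
  obtain ⟨-, h0, h1⟩ := mdmProbs.simplex hp hS
  refine ⟨h0 i hi, ?_⟩
  rw [← h1]
  exact Finset.single_le_sum h0 hi

lemma survivalData_productData (hp : p ∈ mdmProbs 𝒮) {f : Finset (Fin n) → ℝ}
    (hf : OrderCompatible 𝒮 p f) (i : Fin n) : SurvivalData (productData 𝒮 p f i) := by
  refine ⟨fun a ha => ?_, fun a ha b hb => ?_⟩
  · obtain ⟨S, hS, hi, rfl⟩ := mem_productData.1 ha
    exact prob_mem_unitInterval hp hS hi
  · obtain ⟨S, hS, hi, rfl⟩ := mem_productData.1 ha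
    obtain ⟨T, hT, hi', rfl⟩ := mem_productData.1 hb
    exact ⟨(hf S hS T hT i hi hi').1, fun h h0 _ => (hf S hS T hT i hi hi').2 h h0.ne'⟩

lemma survival_mem_consistentChoices (hp : p ∈ mdmProbs 𝒮) (hA : A.Nonempty) (hA𝒮 : A ∉ 𝒮)
    {f : Finset (Fin n) → ℝ} {μ : Fin n → Measure ℝ} (hμ : ∀ i, IsMDMMarginal (μ i))
    (hfit : ∀ S ∈ 𝒮, ∀ i ∈ S, survival 0 (μ i) (f S) = p S i) {l : ℝ}
    (hl : ∑ i ∈ A, survival 0 (μ i) l = 1) :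
    (fun i => survival 0 (μ i) l) ∈ consistentChoices 𝒮 p A := by
  refine ⟨fun _ => 0, μ, hμ, fun S hS => ?_⟩
  rcases Finset.mem_insert.1 hS with rfl | hS
  · rw [Function.update_self]
    exact isMDMChoice_of_survival hμ hA hl fun i _ => rfl
  · rw [Function.update_of_ne (ne_of_mem_of_not_mem hS hA𝒮)]
    obtain ⟨hne, -, h1⟩ := mdmProbs.simplex hp hS
    refine isMDMChoice_of_survival hμ hne (l := f S) ?_ fun i hi => (hfit S hS i hi).symm
    rw [← h1]
    exact Finset.sum_congr rfl fun i hi => hfit S hS i hi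

/-- Moving the threshold so that the survival probabilities sum to one changes each of them by
at most the initial defect. -/
lemma exists_threshold_near (hA : A.Nonempty) {μ : Fin n → Measure ℝ}
    (hμ : ∀ i, IsMDMMarginal (μ i)) (hone : ∀ i, ∃ t, survival 0 (μ i) t = 1) (t : ℝ) :
    ∃ l, ∑ i ∈ A, survival 0 (μ i) l = 1 ∧ ∀ i ∈ A,
      |survival 0 (μ i) l - survival 0 (μ i) t| ≤ |∑ i ∈ A, survival 0 (μ i) t - 1| := by
  have hcont := continuous_sum_survival (ν := fun _ => 0) (S := A) hμ
  have htop : Tendsto (fun t => ∑ i ∈ A, survival 0 (μ i) t) atTop (𝓝 0) := by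
    have := tendsto_finsetSum A fun i _ => (hμ i).tendsto_survival_atTop 0
    simpa using this
  obtain ⟨b, hb⟩ := (htop.eventually (gt_mem_nhds zero_lt_one)).exists
  obtain ⟨k, hk⟩ := hA
  -- Reaching level `1` matters when `A` is a singleton, where the sum could otherwise stay below
  -- one.
  obtain ⟨a, ha⟩ := hone k
  have ha' : 1 ≤ ∑ i ∈ A, survival 0 (μ i) a := by
    rw [← ha]
    exact Finset.single_le_sum (f := fun j => survival 0 (μ j) a)
      (fun j _ => (hμ j).survival_nonneg _ _) hk
  obtain ⟨l, hl⟩ := mem_range_of_exists_le_of_exists_ge hcont ⟨b, hb.le⟩ ⟨a, ha'⟩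
  refine ⟨l, hl, fun i hi => ?_⟩
  simp only at hl
  rw [← hl, ← Finset.sum_sub_distrib]
  -- Moving the threshold changes all coordinates in the same direction, so each change is at most
  -- their total.
  rcases le_total l t with h | h
  · have h1 : ∀ j, 0 ≤ survival 0 (μ j) l - survival 0 (μ j) t := fun j =>
      sub_nonneg.2 ((hμ j).antitone_survival 0 h)
    rw [abs_of_nonneg (h1 i), ← abs_neg, ← Finset.sum_neg_distrib]
    simp_rw [neg_sub]
    rw [abs_of_nonneg (Finset.sum_nonneg fun j _ => h1 j)]
    exact Finset.single_le_sum (f := fun j => survival 0 (μ j) l - survival 0 (μ j) t)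
      (fun j _ => h1 j) hi
  · have h1 : ∀ j, 0 ≤ survival 0 (μ j) t - survival 0 (μ j) l := fun j =>
      sub_nonneg.2 ((hμ j).antitone_survival 0 h)
    rw [abs_sub_comm, abs_of_nonneg (h1 i), abs_of_nonneg (Finset.sum_nonneg fun j _ => h1 j)]
    exact Finset.single_le_sum (f := fun j => survival 0 (μ j) t - survival 0 (μ j) l)
      (fun j _ => h1 j) hi

/-- Interpolating marginals for data that admit compatible thresholds. -/
lemma exists_marginals_of_orderCompatible (hp : p ∈ mdmProbs 𝒮) {f : Finset (Fin n) → ℝ}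
    (hf : OrderCompatible 𝒮 p f) :
    ∃ μ : Fin n → Measure ℝ, (∀ i, IsMDMMarginal (μ i)) ∧
      (∀ S ∈ 𝒮, ∀ i ∈ S, survival 0 (μ i) (f S) = p S i) ∧
      ∀ i, ∃ t, survival 0 (μ i) t = 1 := by
  choose μ hμ hfit hone using fun i => (survivalData_productData hp hf i).exists_marginal
  exact ⟨μ, hμ, fun S hS i hi => hfit i (f S, p S i) (mem_productData.2 ⟨S, hS, hi, rfl⟩), hone⟩

/-- Marginals fitted to the data already determine choice probabilities for `A`, at a threshold
where the survival probabilities sum to one. -/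
lemma consistentChoices_nonempty (hp : p ∈ mdmProbs 𝒮) (hA : A.Nonempty) (hA𝒮 : A ∉ 𝒮)
    {f : Finset (Fin n) → ℝ} (hf : OrderCompatible 𝒮 p f) :
    (consistentChoices 𝒮 p A).Nonempty := by
  obtain ⟨μ, hμ, hfit, hone⟩ := exists_marginals_of_orderCompatible hp hf
  obtain ⟨l, hl, -⟩ := exists_threshold_near hA hμ hone 0
  exact ⟨_, survival_mem_consistentChoices hp hA hA𝒮 hμ hfit hl⟩

/-- A probability vector on `A` that is weakly compatible with the data at some threshold `t`
is approximated by consistent choice vectors. -/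
lemma exists_consistentChoice_near (hp : p ∈ mdmProbs 𝒮) (hA : A.Nonempty) (hA𝒮 : A ∉ 𝒮)
    {f : Finset (Fin n) → ℝ} (hf : OrderCompatible 𝒮 p f) {x : Fin n → ℝ} {t : ℝ}
    (hx0 : ∀ i ∈ A, 0 ≤ x i) (hx1 : ∑ i ∈ A, x i = 1)
    (hle : ∀ S ∈ 𝒮, ∀ i ∈ A, i ∈ S → f S ≤ t → x i ≤ p S i)
    (hge : ∀ S ∈ 𝒮, ∀ i ∈ A, i ∈ S → t ≤ f S → p S i ≤ x i)
    {η : ℝ} (hη0 : 0 < η) (hη1 : η < 1) :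
    ∃ y ∈ consistentChoices 𝒮 p A, ∀ i ∈ A, |y i - x i| ≤ (A.card + 1) * η := by
  classical
  obtain ⟨κ, hκ, hκfit, -⟩ := exists_marginals_of_orderCompatible hp hf
  have hxle : ∀ i ∈ A, x i ≤ 1 := fun i hi => by
    rw [← hx1]; exact Finset.single_le_sum hx0 hi
  -- The fitted survival values at `t` meet the data only at equal thresholds or at levels `0` and
  -- `1`. Any positive weight `η` on them passes this on to `y`, as `x` satisfies the weak
  -- inequalities.
  let y : Fin n → ℝ := fun i => (1 - η) * x i + η * survival 0 (κ i) t
  have hy : ∀ i, y i = (1 - η) * x i + η * survival 0 (κ i) t := fun i => rfl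
  have hy01 : ∀ i ∈ A, 0 ≤ y i ∧ y i ≤ 1 := fun i hi => by
    have h0 := hx0 i hi
    have h1 := hxle i hi
    have g0 := (hκ i).survival_nonneg 0 t
    have g1 := (hκ i).survival_le_one 0 t
    constructor
    · have := mul_nonneg (sub_nonneg.2 hη1.le) h0
      have := mul_nonneg hη0.le g0
      rw [hy]; linarith
    · have := mul_le_mul_of_nonneg_left h1 (sub_nonneg.2 hη1.le)
      have := mul_le_mul_of_nonneg_left g1 hη0.le
      rw [hy]; linarith
  have hyx : ∀ i ∈ A, |y i - x i| ≤ η := fun i hi => by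
    have h0 := hx0 i hi
    have h1 := hxle i hi
    have g0 := (hκ i).survival_nonneg 0 t
    have g1 := (hκ i).survival_le_one 0 t
    have : y i - x i = η * (survival 0 (κ i) t - x i) := by rw [hy]; ring
    rw [this, abs_mul, abs_of_pos hη0]
    exact mul_le_of_le_one_right hη0.le (abs_le.2 ⟨by linarith, by linarith⟩)
  -- the point `(t, y i)` is strictly compatible with the data except at the levels `0` and `1`
  have habove : ∀ S ∈ 𝒮, ∀ i ∈ A, i ∈ S → f S < t →
      y i ≤ p S i ∧ (y i = p S i → p S i = 0 ∨ p S i = 1) := by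
    intro S hS i hi hiS hlt
    have h1 := hle S hS i hi hiS hlt.le
    have h2 : survival 0 (κ i) t ≤ p S i := by
      rw [← hκfit S hS i hiS]; exact (hκ i).antitone_survival 0 hlt.le
    have h3 := mul_le_mul_of_nonneg_left h1 (sub_nonneg.2 hη1.le)
    have h4 := mul_le_mul_of_nonneg_left h2 hη0.le
    refine ⟨by rw [hy]; linarith, fun heq => ?_⟩
    have h5 : survival 0 (κ i) t = p S i := by
      rw [hy] at heq
      exact mul_left_cancel₀ hη0.ne' (by linarith)
    rw [← h5]
    exact (hκ i).survival_flat 0 hlt (by rw [hκfit S hS i hiS, h5])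
  have hbelow : ∀ S ∈ 𝒮, ∀ i ∈ A, i ∈ S → t < f S →
      p S i ≤ y i ∧ (y i = p S i → p S i = 0 ∨ p S i = 1) := by
    intro S hS i hi hiS hlt
    have h1 := hge S hS i hi hiS hlt.le
    have h2 : p S i ≤ survival 0 (κ i) t := by
      rw [← hκfit S hS i hiS]; exact (hκ i).antitone_survival 0 hlt.le
    have h3 := mul_le_mul_of_nonneg_left h1 (sub_nonneg.2 hη1.le)
    have h4 := mul_le_mul_of_nonneg_left h2 hη0.le
    refine ⟨by rw [hy]; linarith, fun heq => ?_⟩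
    have h5 : survival 0 (κ i) t = p S i := by
      rw [hy] at heq
      exact mul_left_cancel₀ hη0.ne' (by linarith)
    have := (hκ i).survival_flat 0 hlt (by rw [hκfit S hS i hiS, h5])
    rwa [hκfit S hS i hiS] at this
  have hmid : ∀ S ∈ 𝒮, ∀ i ∈ A, i ∈ S → f S = t → y i = p S i := by
    intro S hS i hi hiS heq
    have h1 := le_antisymm (hle S hS i hi hiS heq.le) (hge S hS i hi hiS heq.ge)
    rw [hy, ← heq, hκfit S hS i hiS, h1]; ring
  let D : Fin n → Finset (ℝ × ℝ) := fun i =>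
    if i ∈ A then insert (t, y i) (productData 𝒮 p f i) else productData 𝒮 p f i
  have hD : ∀ i, SurvivalData (D i) := by
    intro i
    have hold := survivalData_productData hp hf i
    by_cases hi : i ∈ A
    · simp only [D, if_pos hi]
      refine ⟨fun a ha => ?_, fun a ha b hb => ?_⟩
      · rcases Finset.mem_insert.1 ha with rfl | ha
        · exact hy01 i hi
        · exact hold.1 a ha
      · rcases Finset.mem_insert.1 ha with rfl | ha' <;>
          rcases Finset.mem_insert.1 hb with rfl | hb'
        · simp
        · obtain ⟨S, hS, hiS, rfl⟩ := mem_productData.1 hb'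
          simp only
          rcases lt_trichotomy (f S) t with h | h | h
          · refine ⟨fun _ => h, fun heq h0 h1 => ?_⟩
            rcases (habove S hS i hi hiS h).2 heq with h2 | h2 <;> linarith
          · exact ⟨fun hlt => absurd (hmid S hS i hi hiS h) hlt.ne, fun _ _ _ => h.symm⟩
          · refine ⟨fun hlt => absurd (hbelow S hS i hi hiS h).1 (not_le.2 hlt),
              fun heq h0 h1 => ?_⟩
            rcases (hbelow S hS i hi hiS h).2 heq with h2 | h2 <;> linarith
        · obtain ⟨S, hS, hiS, rfl⟩ := mem_productData.1 ha'
          simp only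
          rcases lt_trichotomy (f S) t with h | h | h
          · refine ⟨fun hlt => absurd (habove S hS i hi hiS h).1 (not_le.2 hlt),
              fun heq h0 h1 => ?_⟩
            rcases (habove S hS i hi hiS h).2 heq.symm with h2 | h2 <;> linarith
          · exact ⟨fun hlt => absurd (hmid S hS i hi hiS h) hlt.ne', fun _ _ _ => h⟩
          · refine ⟨fun _ => h, fun heq h0 h1 => ?_⟩
            rcases (hbelow S hS i hi hiS h).2 heq.symm with h2 | h2 <;> linarith
        · exact hold.2 a ha' b hb'
    · simp only [D, if_neg hi]
      exact hold
  choose μ hμ hfit hone using fun i => (hD i).exists_marginal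
  have hfit𝒮 : ∀ S ∈ 𝒮, ∀ i ∈ S, survival 0 (μ i) (f S) = p S i := by
    intro S hS i hiS
    refine hfit i (f S, p S i) ?_
    have hmem : (f S, p S i) ∈ productData 𝒮 p f i := mem_productData.2 ⟨S, hS, hiS, rfl⟩
    by_cases hi : i ∈ A
    · simp only [D, if_pos hi]; exact Finset.mem_insert_of_mem hmem
    · simp only [D, if_neg hi]; exact hmem
  have hfitA : ∀ i ∈ A, survival 0 (μ i) t = y i := by
    intro i hi
    refine hfit i (t, y i) ?_
    simp only [D, if_pos hi]
    exact Finset.mem_insert_self _ _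
  -- The sum of `y` may miss one by up to `A.card * η`; correcting it moves each coordinate by no
  -- more than that.
  obtain ⟨l, hl, hnear⟩ := exists_threshold_near hA hμ hone t
  refine ⟨_, survival_mem_consistentChoices hp hA hA𝒮 hμ hfit𝒮 hl, fun i hi => ?_⟩
  have h1 := hnear i hi
  rw [hfitA i hi, Finset.sum_congr rfl hfitA, ← hx1, ← Finset.sum_sub_distrib] at h1
  have h2 : |∑ j ∈ A, (y j - x j)| ≤ A.card * η := by
    refine (Finset.abs_sum_le_sum_abs _ _).trans ?_
    have := Finset.sum_le_card_nsmul A (fun j => |y j - x j|) η hyx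
    rwa [nsmul_eq_mul] at this
  have h3 := abs_sub_le (survival 0 (μ i) l) (y i) (x i)
  have h4 := hyx i hi
  linarith

end Sufficiency

/-! ### Comparison with the mixed integer program. -/

section Program

variable {n : ℕ} {𝒮 : Finset (Finset (Fin n))} {p : Finset (Fin n) → Fin n → ℝ}
  {A : Finset (Fin n)} {r : Fin n → ℝ} {ε : ℝ}

lemma MILPFeasible.orderCompatible (hε : 0 < ε) {v : MILPVars n}
    (hv : MILPFeasible 𝒮 p A ε v) : OrderCompatible 𝒮 p v.lam :=
  fun S hS T hT i hiS hiT =>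
    ⟨fun h => by linarith [hv.data_lt S hS T hT i hiS hiT h],
      fun h h0 => sub_eq_zero.1 (hv.data_eq S hS T hT i hiS hiT h h0)⟩

/-- Each binary equal to `1` forces a strict order of the levels, so both cannot be `1`; if both are
`0`, the levels agree and so do the probabilities. -/
lemma MILPFeasible.le_of_le (hε : 0 < ε) {v : MILPVars n} (hv : MILPFeasible 𝒮 p A ε v)
    {S : Finset (Fin n)} (hS : S ∈ 𝒮) {i : Fin n} (hi : i ∈ A) (hiS : i ∈ S) :
    (v.lam S ≤ v.lam A → v.x i ≤ p S i) ∧ (v.lam A ≤ v.lam S → p S i ≤ v.x i) := by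
  have h1 := hv.sign_AS S hS i hi hiS
  have h2 := hv.sign_SA S hS i hi hiS
  have h3 := hv.prob_order S hS i hi hiS
  have h4 := hv.prob_tie S hS i hi hiS
  rcases hv.binary S hS with ⟨ha | ha, hb | hb⟩ <;> rw [ha, hb] at h4 <;>
    rw [ha] at h1 h3 <;> rw [hb] at h2 h3 <;>
    exact ⟨fun _ => by linarith, fun _ => by linarith⟩

/-- Only the closure is reached: the program allows `x i = p S i ≠ 0` with `lam A ≠ lam S`, a tie
that may be impossible in a model. -/
lemma milpValues_subset_closure (hp : p ∈ mdmProbs 𝒮) (hA : A.Nonempty) (hA𝒮 : A ∉ 𝒮)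
    (hε : 0 < ε) : milpValues 𝒮 p A r ε ⊆ closure (consistentRevenues 𝒮 p A r) := by
  rintro _ ⟨v, hv, rfl⟩
  have hv' : MILPFeasible 𝒮 p A ε v := hv
  rw [Metric.mem_closure_iff]
  intro δ hδ
  set C := (∑ i ∈ A, |r i|) * (A.card + 1) with hC
  have hC0 : 0 ≤ C := mul_nonneg (Finset.sum_nonneg fun i _ => abs_nonneg _) (by positivity)
  set η := min (1 / 2) (δ / (2 * (C + 1))) with hη
  have hη0 : 0 < η := lt_min (by norm_num) (by positivity)
  have hη1 : η < 1 := (min_le_left _ _).trans_lt (by norm_num)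
  obtain ⟨y, hy, hnear⟩ := exists_consistentChoice_near hp hA hA𝒮 (hv'.orderCompatible hε)
    hv'.x_nonneg hv'.sum_one (fun S hS i hi hiS => (hv'.le_of_le hε hS hi hiS).1)
    (fun S hS i hi hiS => (hv'.le_of_le hε hS hi hiS).2) hη0 hη1
  refine ⟨_, ⟨y, hy, rfl⟩, ?_⟩
  rw [dist_comm, Real.dist_eq]
  simp only [revenue]
  rw [← Finset.sum_sub_distrib]
  calc |∑ i ∈ A, (r i * y i - r i * v.x i)| ≤ ∑ i ∈ A, |r i| * ((A.card + 1) * η) := by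
        refine (Finset.abs_sum_le_sum_abs _ _).trans (Finset.sum_le_sum fun i hi => ?_)
        rw [← mul_sub, abs_mul]
        exact mul_le_mul_of_nonneg_left (hnear i hi) (abs_nonneg _)
    _ = C * η := by rw [← Finset.sum_mul, hC]; ring
    _ ≤ (C + 1) * (δ / (2 * (C + 1))) := by
        gcongr
        · linarith
        · exact min_le_right _ _
    _ = δ / 2 := by field_simp
    _ < δ := half_lt_self hδ

/-- All variables, including the ones that are not constrained, lie in `[0, 1]`. -/
structure MILPVars.InBox (v : MILPVars n) : Prop where
  x : ∀ i, v.x i ∈ Icc (0 : ℝ) 1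
  lam : ∀ S, v.lam S ∈ Icc (0 : ℝ) 1
  dAS : ∀ S, v.dAS S ∈ Icc (0 : ℝ) 1
  dSA : ∀ S, v.dSA S ∈ Icc (0 : ℝ) 1

/-- Ranks of the model's thresholds, `⊥` included, serve as levels: `𝒮.card + 1` assortments fit
into `[0, 1]` with gaps `ε` because `ε * 𝒮.card ≤ 1`. -/
lemma exists_feasible_of_consistent (hA𝒮 : A ∉ 𝒮) (hε' : ε * (2 * (𝒮.card : ℝ)) < 1)
    (hε : 0 < ε) {x : Fin n → ℝ} (hx : x ∈ consistentChoices 𝒮 p A) :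
    ∃ v : MILPVars n, MILPFeasible 𝒮 p A ε v ∧ v.InBox ∧ revenue r A v.x = revenue r A x := by
  classical
  have hx' : Function.update p A x ∈ mdmProbs (insert A 𝒮) := hx
  obtain ⟨f, hf⟩ := mdmProbs.exists_orderCompatible hx'
  have hcard : (insert A 𝒮).card ≤ 𝒮.card + 1 := Finset.card_insert_le _ _
  have hε1 : ε * (𝒮.card : ℝ) ≤ 1 := by
    have : 0 ≤ ε * (𝒮.card : ℝ) := by positivity
    linarith
  obtain ⟨h, h01, hlt, heq⟩ := exists_unitInterval_levels (insert A 𝒮) f hcard hε1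
  have hAm : A ∈ insert A 𝒮 := Finset.mem_insert_self _ _
  have hm : ∀ {S}, S ∈ 𝒮 → S ∈ insert A 𝒮 := fun hS => Finset.mem_insert_of_mem hS
  have hq : ∀ {S}, S ∈ 𝒮 → Function.update p A x S = p S := fun hS =>
    Function.update_of_ne (ne_of_mem_of_not_mem hS hA𝒮) _ _
  have hqA : Function.update p A x A = x := Function.update_self _ _ _
  have hxA : ∀ i ∈ A, 0 ≤ x i ∧ x i ≤ 1 := fun i hi => by
    simpa only [hqA] using prob_mem_unitInterval hx' hAm hi
  have hpS : ∀ S ∈ 𝒮, ∀ i ∈ S, 0 ≤ p S i ∧ p S i ≤ 1 := fun S hS i hi => by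
    simpa only [hq hS] using prob_mem_unitInterval hx' (hm hS) hi
  have hord : ∀ S ∈ 𝒮, ∀ i ∈ A, i ∈ S →
      (x i < p S i → f S < f A) ∧ (p S i < x i → f A < f S) := fun S hS i hi hiS => by
    have h1 := (hf A hAm S (hm hS) i hi hiS).1
    have h2 := (hf S (hm hS) A hAm i hiS hi).1
    rw [hqA, hq hS] at h1 h2
    exact ⟨h1, h2⟩
  let v : MILPVars n :=
    { x := fun i => if i ∈ A then x i else 0
      lam := h
      dAS := fun S => if f A < f S then 1 else 0
      dSA := fun S => if f S < f A then 1 else 0 }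
  have hvx : ∀ i ∈ A, v.x i = x i := fun i hi => if_pos hi
  refine ⟨v, ?_, ⟨fun i => ?_, h01, fun S => ?_, fun S => ?_⟩, ?_⟩
  · have hcases : ∀ S ∈ 𝒮,
        (v.dAS S = 1 ∧ v.dSA S = 0 ∧ h A + ε ≤ h S ∧ f A < f S) ∨
        (v.dAS S = 0 ∧ v.dSA S = 1 ∧ h S + ε ≤ h A ∧ f S < f A) ∨
        (v.dAS S = 0 ∧ v.dSA S = 0 ∧ h A = h S ∧ f A = f S) := by
      intro S hS
      rcases lt_trichotomy (f A) (f S) with hc | hc | hc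
      · exact Or.inl ⟨if_pos hc, if_neg hc.not_gt, hlt A hAm S (hm hS) hc, hc⟩
      · exact Or.inr (Or.inr ⟨if_neg hc.not_lt, if_neg hc.not_gt, heq A S hc, hc⟩)
      · exact Or.inr (Or.inl ⟨if_neg hc.not_gt, if_pos hc, hlt S (hm hS) A hAm hc, hc⟩)
    have hprob : ∀ S ∈ 𝒮, ∀ i ∈ A, i ∈ S →
        (f A ≤ f S → p S i ≤ v.x i) ∧ (f S ≤ f A → v.x i ≤ p S i) := fun S hS i hi hiS => by
      rw [hvx i hi]
      exact ⟨fun hc => not_lt.1 fun h' => not_lt.2 hc ((hord S hS i hi hiS).1 h'),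
        fun hc => not_lt.1 fun h' => not_lt.2 hc ((hord S hS i hi hiS).2 h')⟩
    have hlam : v.lam = h := rfl
    refine ⟨fun S hS i hi hiS => ?_, fun S hS i hi hiS => ?_, fun S hS i hi hiS => ?_,
      fun S hS i hi hiS => ?_, fun S hS T hT i hiS hiT hc => ?_,
      fun S hS T hT i hiS hiT hc h0 => ?_, ?_, fun i hi => ?_, h01 A, fun S _ => h01 S,
      fun S hS => ?_⟩
    · have hA1 := h01 A
      have hS1 := h01 S
      rw [hlam]
      rcases hcases S hS with ⟨ha, hb, hc, -⟩ | ⟨ha, hb, hc, -⟩ | ⟨ha, hb, hc, -⟩ <;> rw [ha] <;>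
        constructor <;> linarith
    · have hA1 := h01 A
      have hS1 := h01 S
      rw [hlam]
      rcases hcases S hS with ⟨ha, hb, hc, -⟩ | ⟨ha, hb, hc, -⟩ | ⟨ha, hb, hc, -⟩ <;> rw [hb] <;>
        constructor <;> linarith
    · have hx1 := hxA i hi
      rw [← hvx i hi] at hx1
      have hp1 := hpS S hS i hiS
      have hpr := hprob S hS i hi hiS
      rcases hcases S hS with ⟨ha, hb, -, hc⟩ | ⟨ha, hb, -, hc⟩ | ⟨ha, hb, -, hc⟩ <;> rw [ha, hb]
      · constructor <;> linarith [hpr.1 hc.le]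
      · constructor <;> linarith [hpr.2 hc.le]
      · constructor <;> linarith
    · have hx1 := hxA i hi
      rw [← hvx i hi] at hx1
      have hp1 := hpS S hS i hiS
      have hpr := hprob S hS i hi hiS
      rcases hcases S hS with ⟨ha, hb, -, hc⟩ | ⟨ha, hb, -, hc⟩ | ⟨ha, hb, -, hc⟩ <;> rw [ha, hb]
      · constructor <;> linarith
      · constructor <;> linarith
      · constructor <;> linarith [hpr.1 hc.le, hpr.2 hc.ge]
    · have := (hf S (hm hS) T (hm hT) i hiS hiT).1
      rw [hq hS, hq hT] at this
      have := hlt T (hm hT) S (hm hS) (this hc)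
      rw [hlam]
      linarith
    · have := (hf S (hm hS) T (hm hT) i hiS hiT).2
      rw [hq hS, hq hT] at this
      exact sub_eq_zero.2 (heq S T (this hc h0))
    · rw [Finset.sum_congr rfl hvx]
      simpa only [hqA] using (mdmProbs.simplex hx' hAm).2.2
    · rw [hvx i hi]
      exact (hxA i hi).1
    · rcases hcases S hS with ⟨ha, hb, -, -⟩ | ⟨ha, hb, -, -⟩ | ⟨ha, hb, -, -⟩ <;> simp [ha, hb]
  · by_cases hi : i ∈ A
    · rw [hvx i hi]
      exact hxA i hi
    · simp [v, hi]
  · simp only [v]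
    split_ifs <;> simp
  · simp only [v]
    split_ifs <;> simp
  · exact Finset.sum_congr rfl fun i hi => by rw [hvx i hi]

/-- The variables of the program as a point of a product space. -/
abbrev MILPPoint (n : ℕ) : Type :=
  (Fin n → ℝ) × (Finset (Fin n) → ℝ) × (Finset (Fin n) → ℝ) × (Finset (Fin n) → ℝ)

/-- The variables of the program read off a point of the product space. -/
def MILPPoint.toVars (q : MILPPoint n) : MILPVars n := ⟨q.1, q.2.1, q.2.2.1, q.2.2.2⟩

/-- Strict comparisons and `≠` involve the data only; the variables meet weak inequalities,
equations and finite alternatives. -/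
lemma isClosed_feasible :
    IsClosed {q : MILPPoint n | MILPFeasible 𝒮 p A ε q.toVars} := by
  have hiff : ∀ q : MILPPoint n, MILPFeasible 𝒮 p A ε q.toVars ↔
      (∀ S ∈ 𝒮, ∀ i ∈ A, i ∈ S →
        ((-q.2.2.1 S ≤ q.2.1 A - q.2.1 S ∧ q.2.1 A - q.2.1 S ≤ 1 - (1 + ε) * q.2.2.1 S) ∧
        (-q.2.2.2 S ≤ q.2.1 S - q.2.1 A ∧ q.2.1 S - q.2.1 A ≤ 1 - (1 + ε) * q.2.2.2 S) ∧
        (q.2.2.1 S - 1 ≤ q.1 i - p S i ∧ q.1 i - p S i ≤ 1 - q.2.2.2 S) ∧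
        (-(q.2.2.1 S + q.2.2.2 S) ≤ q.1 i - p S i ∧
          q.1 i - p S i ≤ q.2.2.1 S + q.2.2.2 S))) ∧
      (∀ S ∈ 𝒮, ∀ T ∈ 𝒮, ∀ i ∈ S, i ∈ T →
        ((p S i < p T i → ε ≤ q.2.1 S - q.2.1 T) ∧
        (p S i = p T i → p S i ≠ 0 → q.2.1 S - q.2.1 T = 0))) ∧
      (∑ i ∈ A, q.1 i = 1 ∧ (∀ i ∈ A, 0 ≤ q.1 i) ∧ (0 ≤ q.2.1 A ∧ q.2.1 A ≤ 1)) ∧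
      (∀ S ∈ 𝒮, (0 ≤ q.2.1 S ∧ q.2.1 S ≤ 1) ∧
        (q.2.2.1 S = 0 ∨ q.2.2.1 S = 1) ∧ (q.2.2.2 S = 0 ∨ q.2.2.2 S = 1)) := by
    intro q
    constructor
    · intro h
      exact ⟨fun S hS i hi hiS => ⟨h.sign_AS S hS i hi hiS, h.sign_SA S hS i hi hiS,
        h.prob_order S hS i hi hiS, h.prob_tie S hS i hi hiS⟩,
        fun S hS T hT i hiS hiT => ⟨h.data_lt S hS T hT i hiS hiT, h.data_eq S hS T hT i hiS hiT⟩,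
        ⟨h.sum_one, h.x_nonneg, h.lam_A⟩, fun S hS => ⟨h.lam_S S hS, h.binary S hS⟩⟩
    · rintro ⟨h1, h2, h3, h4⟩
      exact ⟨fun S hS i hi hiS => (h1 S hS i hi hiS).1,
        fun S hS i hi hiS => (h1 S hS i hi hiS).2.1,
        fun S hS i hi hiS => (h1 S hS i hi hiS).2.2.1,
        fun S hS i hi hiS => (h1 S hS i hi hiS).2.2.2,
        fun S hS T hT i hiS hiT => (h2 S hS T hT i hiS hiT).1,
        fun S hS T hT i hiS hiT => (h2 S hS T hT i hiS hiT).2,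
        h3.1, h3.2.1, h3.2.2, fun S hS => (h4 S hS).1, fun S hS => (h4 S hS).2⟩
  simp only [hiff, Set.ofPred_and, Set.ofPred_or, Set.ofPred_forall]
  refine IsClosed.inter ?_ (IsClosed.inter ?_ (IsClosed.inter ?_ ?_))
  · refine isClosed_iInter fun S => isClosed_iInter fun _ => isClosed_iInter fun i =>
      isClosed_iInter fun _ => isClosed_iInter fun _ => ?_
    refine IsClosed.inter (IsClosed.inter ?_ ?_) (IsClosed.inter (IsClosed.inter ?_ ?_)
      (IsClosed.inter (IsClosed.inter ?_ ?_) (IsClosed.inter ?_ ?_))) <;>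
      exact isClosed_le (by fun_prop) (by fun_prop)
  · refine isClosed_iInter fun S => isClosed_iInter fun _ => isClosed_iInter fun T =>
      isClosed_iInter fun _ => isClosed_iInter fun i => isClosed_iInter fun _ =>
      isClosed_iInter fun _ => IsClosed.inter ?_ ?_
    · exact isClosed_iInter fun _ => isClosed_le (by fun_prop) (by fun_prop)
    · exact isClosed_iInter fun _ => isClosed_iInter fun _ =>
        isClosed_eq (by fun_prop) (by fun_prop)
  · refine IsClosed.inter (isClosed_eq (by fun_prop) (by fun_prop))
      (IsClosed.inter ?_ (IsClosed.inter ?_ ?_))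
    · exact isClosed_iInter fun _ => isClosed_iInter fun _ =>
        isClosed_le (by fun_prop) (by fun_prop)
    all_goals exact isClosed_le (by fun_prop) (by fun_prop)
  · refine isClosed_iInter fun S => isClosed_iInter fun _ =>
      IsClosed.inter (IsClosed.inter ?_ ?_)
        (IsClosed.inter (IsClosed.union ?_ ?_) (IsClosed.union ?_ ?_))
    · exact isClosed_le (by fun_prop) (by fun_prop)
    · exact isClosed_le (by fun_prop) (by fun_prop)
    all_goals exact isClosed_eq (by fun_prop) (by fun_prop)

/-- The objective values of the feasible points in the unit box form a compact set. -/
lemma isCompact_boxValues :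
    IsCompact ((fun v : MILPVars n => revenue r A v.x) ''
      {v | MILPFeasible 𝒮 p A ε v ∧ v.InBox}) := by
  have hbox : IsCompact ((univ.pi fun _ => Icc 0 1) ×ˢ (univ.pi fun _ => Icc 0 1) ×ˢ
      (univ.pi fun _ => Icc 0 1) ×ˢ (univ.pi fun _ => Icc 0 1) : Set (MILPPoint n)) := by
    have h : ∀ (ι : Type), IsCompact (univ.pi fun _ : ι => Icc (0 : ℝ) 1) := fun ι =>
      isCompact_univ_pi fun _ => isCompact_Icc
    exact (h _).prod ((h _).prod ((h _).prod (h _)))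
  have hK := hbox.inter_left (isClosed_feasible (𝒮 := 𝒮) (p := p) (A := A) (ε := ε))
  have hcont : Continuous fun q : MILPPoint n => revenue r A q.1 := by
    unfold revenue; fun_prop
  convert hK.image hcont using 1
  ext y
  constructor
  · rintro ⟨v, ⟨hv, hb⟩, rfl⟩
    exact ⟨(v.x, v.lam, v.dAS, v.dSA), ⟨hv, fun i _ => hb.x i, fun S _ => hb.lam S,
      fun S _ => hb.dAS S, fun S _ => hb.dSA S⟩, rfl⟩
  · rintro ⟨q, ⟨hq, hb1, hb2, hb3, hb4⟩, rfl⟩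
    exact ⟨MILPPoint.toVars q, ⟨hq, fun i => hb1 i trivial, fun S => hb2 S trivial,
      fun S => hb3 S trivial, fun S => hb4 S trivial⟩, rfl⟩

end Program

/-! ### Attainment of the two extrema. -/

theorem proposition2 {n : ℕ} (𝒮 : Finset (Finset (Fin n)))
    (p : Finset (Fin n) → Fin n → ℝ) (hp : p ∈ mdmProbs 𝒮)
    (A : Finset (Fin n)) (hA : A.Nonempty) (hA𝒮 : A ∉ 𝒮)
    (r : Fin n → ℝ) (hr : ∀ i, 0 < r i)
    (ε : ℝ) (hε : 0 < ε) (hε' : ε * (2 * (𝒮.card : ℝ)) < 1) :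
    -- the infimum and the supremum that define the two revenues are proper
    ((consistentRevenues 𝒮 p A r).Nonempty ∧ BddBelow (consistentRevenues 𝒮 p A r) ∧
      BddAbove (consistentRevenues 𝒮 p A r)) ∧
    -- they are the minimum and the maximum of the program
    IsLeast (milpValues 𝒮 p A r ε) (worstCaseRevenue 𝒮 p A r) ∧
    IsGreatest (milpValues 𝒮 p A r ε) (optimisticRevenue 𝒮 p A r) := by
  have hne : (consistentRevenues 𝒮 p A r).Nonempty := by
    obtain ⟨f, hf⟩ := mdmProbs.exists_orderCompatible hp
    have hε1 : ε * (𝒮.card : ℝ) ≤ 1 := by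
      have : 0 ≤ ε * (𝒮.card : ℝ) := by positivity
      linarith
    obtain ⟨h, -, hlt, heq⟩ := exists_unitInterval_levels 𝒮 f (Nat.le_succ _) hε1
    refine (consistentChoices_nonempty hp hA hA𝒮 (f := h) fun S hS T hT i hiS hiT => ?_).image _
    have h1 := hf S hS T hT i hiS hiT
    exact ⟨fun hc => by linarith [hlt T hT S hS (h1.1 hc)], fun hc h0 => heq S T (h1.2 hc h0)⟩
  -- Entries outside the constraints are free, so the feasible set itself need not be compact; the
  -- box restores compactness and still captures every consistent revenue.
  set K := (fun v : MILPVars n => revenue r A v.x) '' {v | MILPFeasible 𝒮 p A ε v ∧ v.InBox}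
  have hK : IsCompact K := isCompact_boxValues
  have hsub : consistentRevenues 𝒮 p A r ⊆ K := by
    rintro _ ⟨x, hx, rfl⟩
    obtain ⟨v, hv, hb, hrev⟩ := exists_feasible_of_consistent (r := r) hA𝒮 hε' hε hx
    exact ⟨v, ⟨hv, hb⟩, hrev⟩
  have hKmilp : K ⊆ milpValues 𝒮 p A r ε := image_mono fun v hv => hv.1
  have hcl : closure (consistentRevenues 𝒮 p A r) ⊆ K := closure_minimal hsub hK.isClosed
  have hmilp := milpValues_subset_closure (r := r) hp hA hA𝒮 hε
  have hbelow : BddBelow (consistentRevenues 𝒮 p A r) := hK.bddBelow.mono hsub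
  have habove : BddAbove (consistentRevenues 𝒮 p A r) := hK.bddAbove.mono hsub
  refine ⟨⟨hne, hbelow, habove⟩, ⟨hKmilp (hcl (csInf_mem_closure hne hbelow)), fun y hy => ?_⟩,
    ⟨hKmilp (hcl (csSup_mem_closure hne habove)), fun y hy => ?_⟩⟩
  · exact closure_minimal (fun z hz => csInf_le hbelow hz) isClosed_Ici (hmilp hy)
  · exact closure_minimal (fun z hz => le_csSup habove hz) isClosed_Iic (hmilp hy)

end
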